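/- Fix $\theta>1$. For $n\ge 1$ and $\mu\in\mathbb{R}^n$ let $X=(X_1,\dots,X_n)\in\{\pm1\}^n$ follow the Curie–Weiss model $$\mathbb{P}_{\theta,\mu}(X=x)=\frac{1}{Z(\theta,\mu)}\exp\Big(\frac{\theta}{n}\sum_{1\le i<j\le n}x_ix_j+\sum_{i=1}^n\mu_ix_i\Big),\qquad x\in\{\pm1\}^n,$$ where $Z(\theta,\mu)$ is the normalizing constant. Let $s=s_n$ be integers with $0\le s_n\le n$ and let $B=B_n>0$ be real numbers. Consider testing $H_0:\mu=0$ against $H_1:\mu\in\Xi(s,B)$, where $\Xi(s,B)$ is the set of all $\mu\in\mathbb{R}^n$ that have exactly $s$ nonzero coordinates, each of which is at least $B$. The risk of a test $T:\{\pm1\}^n\to\{0,1\}$ (where $1$ means that $H_0$ is rejected) is $$\mathrm{Risk}(T)=\mathbb{P}_{\theta,0}(T(X)=1)+\sup_{\mu\in\Xi(s,B)}\mathbb{P}_{\theta,\mu}(T(X)=0),$$ and a sequence $(T_n)$ of tests is asymptotically powerful if $\limsup_{n\to\infty}\mathrm{Risk}(T_n)=0$. Put $$\tilde X=\frac1n\sum_{i=1}^n\Big[X_i-\tanh\Big(\frac{\theta}{n}\sum_{j\ne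 i}X_j\Big)\Big].$$ (a) If $\sqrt n=o(s\tanh(B))$, then there are sequences $L_n\to\infty$ with $L_n=o(n^{-1/2}s\tanh(B))$, and for every such sequence the test that rejects $H_0$ if and only if $\sqrt n\,\tilde X\ge L_n$ is asymptotically powerful. (b) If $s\tanh(B)=O(\sqrt n)$, then no sequence of tests is asymptotically powerful. -/

import Mathlib

open Filter Asymptotics

namespace CurieWeiss

/-- Configurations `x ∈ {±1}ⁿ`; `ℤˣ` is the set `{1, -1}`. -/
abbrev Config (n : ℕ) : Type := Fin n → ℤˣ

/-- The value `±1` of the `i`-th coordinate, as a real number. -/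
def spin {n : ℕ} (x : Config n) (i : Fin n) : ℝ := ((x i : ℤ) : ℝ)

noncomputable section

/-- The unnormalised density
`exp ((θ / n) ∑_{i < j} x_i x_j + ∑_i μ_i x_i)` of the Curie-Weiss model. -/
def weight {n : ℕ} (θ : ℝ) (μ : Fin n → ℝ) (x : Config n) : ℝ :=
  Real.exp (θ / n * (∑ i, ∑ j ∈ Finset.Ioi i, spin x i * spin x j) + ∑ i, μ i * spin x i)

/-- The normalising constant `Z(θ, μ)`. -/
def partitionFn {n : ℕ} (θ : ℝ) (μ : Fin n → ℝ) : ℝ :=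
  ∑ x : Config n, weight θ μ x

/-- The probability `ℙ_{θ,μ}(X ∈ A)` of an event `A ⊆ {±1}ⁿ` under the Curie-Weiss model. -/
def prob {n : ℕ} (θ : ℝ) (μ : Fin n → ℝ) (A : Set (Config n)) : ℝ :=
  ∑ x : Config n, A.indicator (fun y => weight θ μ y / partitionFn θ μ) x

/-- The sparse alternative `Ξ(s, B)`: vectors with exactly `s` nonzero coordinates, each of them
at least `B` (to be used with `B > 0`). -/
def sparseAlt (n s : ℕ) (B : ℝ) : Set (Fin n → ℝ) :=
  {μ | (Function.support μ).ncard = s ∧ ∀ i ∈ Function.support μ, B ≤ μ i}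

/-- A (non-randomised) test: the value `1` means that the null hypothesis `μ = 0` is rejected. -/
abbrev Test (n : ℕ) : Type := Config n → Fin 2

/-- The worst case risk of a test of `μ = 0` against `μ ∈ Ξ(s, B)`. -/
def risk {n : ℕ} (θ : ℝ) (s : ℕ) (B : ℝ) (T : Test n) : ℝ :=
  prob θ 0 {x | T x = 1} + ⨆ μ : sparseAlt n s B, prob θ (μ : Fin n → ℝ) {x | T x = 0}

/-- A sequence of tests is asymptotically powerful if its risk has upper limit `0`.
(The risk always lies in `[0, 2]`, so this real `limsup` is the usual one.) -/
def AsymptoticallyPowerful (θ : ℝ) (s : ℕ → ℕ) (B : ℕ → ℝ) (T : ∀ n, Test n) : Prop :=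
  limsup (fun n => risk θ (s n) (B n) (T n)) atTop = 0

/-- The conditionally centred magnetisation
`X̃ = (1 / n) ∑_i (X_i - tanh ((θ / n) ∑_{j ≠ i} X_j))`. -/
def centredMean {n : ℕ} (θ : ℝ) (x : Config n) : ℝ :=
  1 / n * ∑ i, (spin x i - Real.tanh (θ / n * ∑ j ∈ Finset.univ.erase i, spin x j))

/-- The test that rejects if and only if `√n X̃ ≥ L`. -/
def centredTest (θ L : ℝ) (n : ℕ) : Test n :=
  fun x => if √(n : ℝ) * centredMean θ x ≥ L then 1 else 0

end

end CurieWeiss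

namespace CurieWeiss

/-! ### The hyperbolic tangent -/

/-! Detection. Under the model with field `μ`, the conditional mean of `X_i` given the other spins
is `tanh (localField + μ_i)`. The sum `centredSum θ μ` of the conditionally centred spins therefore
has second moment `O(n)`, uniformly in `μ`: a spin enters the local field of another only with
weight `θ / n`, so cross terms are `O(1 / n)` (`sum_weight_centredSum_sq_le`). The statistic `n X̃`
is `centredSum θ 0`, and on the alternative it exceeds `centredSum θ μ` pointwise by a constant
times `s tanh B` (`centredSum_add_le`). Chebyshev's inequality then controls both errors.

Impossibility. By the Hubbard-Stratonovich transform the null law is a mixture of laws of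
independent spins with mean `tanh h`, where `h` has density proportional to `exp (-n * rate θ h)`
(`integral_fieldDensity_mul_iidMean`). For `θ > 1` the rate has quadratic wells at `±r`, with `r = θ
tanh r > 0`. The supremum over alternatives is bounded below by the average over all `s`-sets of the
spike of height `B`, whose likelihood ratio is `avgSpike` up to normalisation. For fixed `h` in a
window of width `n^(-1/2)` to the right of `r`, its relative second moment is at most `exp (τ² s² /
n)` with `τ = tanh B`, by the overlap bound `sum_pow_card_inter_le`; this is bounded when `s τ =
O(√n)`. Laplace estimates show that the window carries a fixed share of the mass both under the null
and under the averaged alternative. Hence no test separates the two (`exists_le_risk`). -/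

theorem hasDerivAt_tanh (x : ℝ) : HasDerivAt Real.tanh (1 - Real.tanh x ^ 2) x := by
  have h := (Real.hasDerivAt_sinh x).div (Real.hasDerivAt_cosh x) (Real.cosh_pos x).ne'
  have e : (Real.sinh / Real.cosh) = Real.tanh := by
    funext y; simp [Real.tanh_eq_sinh_div_cosh]
  rw [e] at h
  refine h.congr_deriv ?_
  have := (Real.cosh_pos x).ne'
  rw [Real.tanh_eq_sinh_div_cosh]
  field_simp

theorem differentiable_tanh : Differentiable ℝ Real.tanh :=
  fun x => (hasDerivAt_tanh x).differentiableAt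

theorem deriv_tanh (x : ℝ) : deriv Real.tanh x = 1 - Real.tanh x ^ 2 := (hasDerivAt_tanh x).deriv

theorem continuous_tanh : Continuous Real.tanh := differentiable_tanh.continuous

theorem tanh_strictMono : StrictMono Real.tanh := by
  refine strictMono_of_deriv_pos fun x => ?_
  rw [deriv_tanh]
  linarith [Real.tanh_sq_lt_one x]

theorem tanh_pos {x : ℝ} (hx : 0 < x) : 0 < Real.tanh x := by
  simpa using tanh_strictMono hx

theorem abs_tanh_sub_tanh_le (x y : ℝ) : |Real.tanh x - Real.tanh y| ≤ |x - y| := by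
  have h := Convex.norm_image_sub_le_of_norm_deriv_le (f := Real.tanh) (C := 1) (s := Set.univ)
    (x := y) (y := x) (fun x _ => differentiable_tanh x) (fun x _ => by
      rw [deriv_tanh, Real.norm_eq_abs, abs_le]
      constructor <;> nlinarith [Real.tanh_sq_lt_one x, sq_nonneg (Real.tanh x)])
    convex_univ trivial trivial
  simpa using h

theorem tanh_add (a b : ℝ) : Real.tanh (a + b) =
    (Real.tanh a + Real.tanh b) / (1 + Real.tanh a * Real.tanh b) := by
  have ha := (Real.cosh_pos a).ne'
  have hb := (Real.cosh_pos b).ne'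
  have hab := (Real.cosh_pos (a + b)).ne'
  rw [Real.cosh_add] at hab
  have h2 : 1 + Real.sinh a / Real.cosh a * (Real.sinh b / Real.cosh b) ≠ 0 := by
    intro h
    apply hab
    field_simp at h
    linarith
  rw [Real.tanh_eq_sinh_div_cosh, Real.tanh_eq_sinh_div_cosh, Real.tanh_eq_sinh_div_cosh,
    Real.sinh_add, Real.cosh_add, div_eq_div_iff hab h2]
  field_simp

/-- By the addition formula the increment is `tanh b * (1 - tanh² a) / (1 + tanh a * tanh b)`, whose
denominator is at most `2`. The bound is in terms of `tanh b`, not `b`, so it remains useful for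
large and for small signals. -/
theorem le_tanh_add_sub_tanh {a b r : ℝ} (ha : |a| ≤ r) (hb : 0 ≤ b) :
    Real.tanh b * ((1 - Real.tanh r ^ 2) / 2) ≤ Real.tanh (a + b) - Real.tanh a := by
  have h1 := abs_lt.1 (Real.abs_tanh_lt_one a)
  have h2 := Real.tanh_lt_one b
  have h3 : 0 ≤ Real.tanh b := by simpa using tanh_strictMono.monotone hb
  have h4 : Real.tanh a ^ 2 ≤ Real.tanh r ^ 2 := by
    have e1 := tanh_strictMono.monotone (abs_le.1 ha).1
    have e2 := tanh_strictMono.monotone (abs_le.1 ha).2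
    rw [Real.tanh_neg] at e1
    exact sq_le_sq' e1 e2
  have h5 : 0 < 1 + Real.tanh a * Real.tanh b := by nlinarith
  have h6 : 1 + Real.tanh a * Real.tanh b ≤ 2 := by nlinarith
  have h7 := Real.tanh_sq_lt_one r
  have e : Real.tanh (a + b) - Real.tanh a =
      Real.tanh b * ((1 - Real.tanh a ^ 2) / (1 + Real.tanh a * Real.tanh b)) := by
    rw [tanh_add]
    field_simp
    ring
  rw [e]
  refine mul_le_mul_of_nonneg_left ?_ h3
  exact div_le_div₀ (by linarith) (by linarith) h5 h6

/-! ### Spins and the Gibbs weight -/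

variable {n : ℕ}

theorem spin_eq_or (x : Config n) (i : Fin n) : spin x i = 1 ∨ spin x i = -1 := by
  rcases Int.units_eq_one_or (x i) with h | h <;> simp [spin, h]

theorem spin_sq (x : Config n) (i : Fin n) : spin x i ^ 2 = 1 := by
  rcases spin_eq_or x i with h | h <;> simp [h]

theorem abs_spin (x : Config n) (i : Fin n) : |spin x i| = 1 := by
  rcases spin_eq_or x i with h | h <;> simp [h]

theorem sum_spin_sq (x : Config n) :
    (∑ i, spin x i) ^ 2 = n + 2 * ∑ i, ∑ j ∈ Finset.Ioi i, spin x i * spin x j := by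
  have h1 : (∑ i, spin x i) ^ 2 = ∑ i, ∑ j, spin x i * spin x j := by
    rw [sq, Finset.sum_mul_sum]
  have h2 : ∀ i : Fin n, ∑ j, spin x i * spin x j = 1 + ∑ j ∈ Finset.Ioi i, spin x i * spin x j
      + ∑ j ∈ Finset.Iio i, spin x i * spin x j := by
    intro i
    have hu : (Finset.univ : Finset (Fin n)) =
        ({i} : Finset (Fin n)) ∪ Finset.Ioi i ∪ Finset.Iio i := by
      ext j
      simp only [Finset.mem_univ, Finset.mem_union, Finset.mem_singleton, Finset.mem_Ioi,
        Finset.mem_Iio, true_iff]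
      rcases lt_trichotomy i j with h | h | h <;> simp [h]
    rw [hu, Finset.sum_union, Finset.sum_union, Finset.sum_singleton, ← sq, spin_sq]
    · simp
    · rw [Finset.disjoint_left]
      intro j hj hj'
      simp only [Finset.mem_union, Finset.mem_singleton, Finset.mem_Ioi, Finset.mem_Iio] at hj hj'
      rcases hj with h | h
      · exact absurd hj' (by simp [h])
      · exact absurd hj' h.not_gt
  have h3 : ∑ i : Fin n, ∑ j ∈ Finset.Iio i, spin x i * spin x j =
      ∑ i : Fin n, ∑ j ∈ Finset.Ioi i, spin x i * spin x j := by
    rw [Finset.sum_comm' (t' := Finset.univ) (s' := fun j => Finset.Ioi j) (by simp)]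
    exact Finset.sum_congr rfl fun i _ => Finset.sum_congr rfl fun j _ => mul_comm _ _
  rw [h1, Finset.sum_congr rfl fun i _ => h2 i, Finset.sum_add_distrib, Finset.sum_add_distrib, h3]
  simp
  ring

theorem weight_eq (θ : ℝ) (μ : Fin n → ℝ) (x : Config n) :
    weight θ μ x = Real.exp (θ / n * (((∑ i, spin x i) ^ 2 - n) / 2) + ∑ i, μ i * spin x i) := by
  rw [weight, sum_spin_sq]
  congr 3
  ring

theorem weight_pos (θ : ℝ) (μ : Fin n → ℝ) (x : Config n) : 0 < weight θ μ x := Real.exp_pos _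

theorem partitionFn_pos (θ : ℝ) (μ : Fin n → ℝ) : 0 < partitionFn θ μ :=
  Finset.sum_pos (fun x _ => weight_pos θ μ x) Finset.univ_nonempty

theorem prob_nonneg (θ : ℝ) (μ : Fin n → ℝ) (A : Set (Config n)) : 0 ≤ prob θ μ A :=
  Finset.sum_nonneg fun x _ => Set.indicator_nonneg
    (fun y _ => (div_pos (weight_pos θ μ y) (partitionFn_pos θ μ)).le) x

theorem prob_eq_div (θ : ℝ) (μ : Fin n → ℝ) (A : Set (Config n)) :
    prob θ μ A = (∑ x, A.indicator (weight θ μ) x) / partitionFn θ μ := by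
  rw [prob, Finset.sum_div]
  refine Finset.sum_congr rfl fun x _ => ?_
  by_cases hx : x ∈ A <;> simp [hx]

theorem prob_le_one (θ : ℝ) (μ : Fin n → ℝ) (A : Set (Config n)) : prob θ μ A ≤ 1 := by
  rw [prob_eq_div, div_le_one (partitionFn_pos θ μ)]
  exact Finset.sum_le_sum fun x _ => Set.indicator_le_self' (fun _ _ => (weight_pos θ μ _).le) x

/-! ### Conditional centring -/

/-- The local field at site `i`, without the site itself. -/
noncomputable def localField (θ : ℝ) (x : Config n) (i : Fin n) : ℝ :=
  θ / n * ∑ j ∈ Finset.univ.erase i, spin x j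

/-- Flip the spin at site `i`. -/
def flipAt (i : Fin n) (x : Config n) : Config n := Function.update x i (-x i)

theorem flipAt_flipAt (i : Fin n) (x : Config n) : flipAt i (flipAt i x) = x := by
  simp [flipAt]

theorem spin_flipAt_self (i : Fin n) (x : Config n) : spin (flipAt i x) i = -spin x i := by
  simp [flipAt, spin]

theorem spin_flipAt_of_ne {i j : Fin n} (h : j ≠ i) (x : Config n) :
    spin (flipAt i x) j = spin x j := by
  simp [flipAt, spin, h]

theorem localField_flipAt (θ : ℝ) (i : Fin n) (x : Config n) :
    localField θ (flipAt i x) i = localField θ x i := by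
  unfold localField
  congr 1
  exact Finset.sum_congr rfl fun j hj => spin_flipAt_of_ne (Finset.ne_of_mem_erase hj) x

theorem sum_weight_flipAt (i : Fin n) (f : Config n → ℝ) : ∑ x, f (flipAt i x) = ∑ x, f x :=
  Equiv.sum_comp (Function.Involutive.toPerm (flipAt i) (flipAt_flipAt i)) f

/-- Given the other spins, `X_i` has a two-point law with log-odds `2 (localField + μ_i)`, hence
mean `tanh (localField + μ_i)`. Pairing `x` with its flip expresses this without conditional
expectations. -/
theorem weight_flip_mul (θ : ℝ) (μ : Fin n → ℝ) (i : Fin n) (x : Config n) :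
    weight θ μ x * (spin x i - Real.tanh (localField θ x i + μ i)) +
      weight θ μ (flipAt i x) * (-spin x i - Real.tanh (localField θ x i + μ i)) = 0 := by
  set m := ∑ j ∈ Finset.univ.erase i, spin x j with hm
  set r := ∑ j ∈ Finset.univ.erase i, μ j * spin x j with hr
  have e1 : ∑ j, spin x j = spin x i + m := (Finset.add_sum_erase _ _ (Finset.mem_univ i)).symm
  have e2 : ∑ j, μ j * spin x j = μ i * spin x i + r :=
    (Finset.add_sum_erase _ _ (Finset.mem_univ i)).symm
  have e3 : ∑ j, spin (flipAt i x) j = -spin x i + m := by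
    rw [← Finset.add_sum_erase _ _ (Finset.mem_univ i), spin_flipAt_self]
    congr 1
    exact Finset.sum_congr rfl fun j hj => spin_flipAt_of_ne (Finset.ne_of_mem_erase hj) x
  have e4 : ∑ j, μ j * spin (flipAt i x) j = μ i * -spin x i + r := by
    rw [← Finset.add_sum_erase _ _ (Finset.mem_univ i), spin_flipAt_self]
    congr 1
    exact Finset.sum_congr rfl fun j hj => by
      rw [spin_flipAt_of_ne (Finset.ne_of_mem_erase hj) x]
  have hs := spin_sq x i
  set a := localField θ x i + μ i with ha
  have ha' : a = θ / n * m + μ i := rfl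
  have w1 : weight θ μ x =
      Real.exp (θ / n * ((1 + m ^ 2 - n) / 2) + r) * Real.exp (a * spin x i) := by
    rw [weight_eq, e1, e2, ← Real.exp_add, ha']
    congr 1
    linear_combination (θ / n / 2) * hs
  have w2 : weight θ μ (flipAt i x) =
      Real.exp (θ / n * ((1 + m ^ 2 - n) / 2) + r) * Real.exp (-(a * spin x i)) := by
    rw [weight_eq, e3, e4, ← Real.exp_add, ha']
    congr 1
    linear_combination (θ / n / 2) * hs
  rw [w1, w2, Real.tanh_eq]
  have hp : Real.exp a + Real.exp (-a) ≠ 0 := by positivity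
  rcases spin_eq_or x i with h | h <;> rw [h] <;> simp only [mul_one, mul_neg, neg_neg] <;>
    field_simp <;> ring

/-- A function that does not see the spin at `i` is uncorrelated with the conditionally centred
spin at `i`. -/
theorem sum_weight_centred_mul (θ : ℝ) (μ : Fin n → ℝ) (i : Fin n) (g : Config n → ℝ)
    (hg : ∀ x, g (flipAt i x) = g x) :
    ∑ x, weight θ μ x * ((spin x i - Real.tanh (localField θ x i + μ i)) * g x) = 0 := by
  have h := sum_weight_flipAt i
    (fun x => weight θ μ x * ((spin x i - Real.tanh (localField θ x i + μ i)) * g x))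
  have h2 : ∑ x, (weight θ μ x * ((spin x i - Real.tanh (localField θ x i + μ i)) * g x) +
      weight θ μ (flipAt i x) * ((spin (flipAt i x) i -
        Real.tanh (localField θ (flipAt i x) i + μ i)) * g (flipAt i x))) = 0 := by
    refine Finset.sum_eq_zero fun x _ => ?_
    rw [hg, localField_flipAt, spin_flipAt_self]
    linear_combination g x * weight_flip_mul θ μ i x
  rw [Finset.sum_add_distrib] at h2
  linarith

/-- The sum of the conditionally centred spins. -/
noncomputable def centredSum (θ : ℝ) (μ : Fin n → ℝ) (x : Config n) : ℝ :=
  ∑ i, (spin x i - Real.tanh (localField θ x i + μ i))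

theorem abs_centred_le (x : Config n) (i : Fin n) (a : ℝ) : |spin x i - Real.tanh a| ≤ 2 := by
  have h1 := abs_sub (spin x i) (Real.tanh a)
  have h2 := Real.abs_tanh_lt_one a
  rw [abs_spin] at h1
  linarith

/-- Deleting spin `i` from the local field at `j` makes the second factor blind to `i`, so the
expectation vanishes. As `tanh` is 1-Lipschitz, the deletion costs at most `θ / n`, multiplied by
the bound `2` on the other factor. -/
theorem sum_weight_centred_mul_centred_le {θ : ℝ} (hθ : 0 ≤ θ) (μ : Fin n → ℝ) {i j : Fin n}
    (hij : i ≠ j) :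
    ∑ x, weight θ μ x * ((spin x i - Real.tanh (localField θ x i + μ i)) *
      (spin x j - Real.tanh (localField θ x j + μ j))) ≤ 2 * θ / n * partitionFn θ μ := by
  set g : Config n → ℝ := fun x =>
    spin x j - Real.tanh (θ / n * ∑ k ∈ (Finset.univ.erase j).erase i, spin x k + μ j) with hgdef
  have hg : ∀ x, g (flipAt i x) = g x := by
    intro x
    simp only [hgdef]
    rw [spin_flipAt_of_ne hij.symm, Finset.sum_congr rfl fun k hk =>
      spin_flipAt_of_ne (Finset.ne_of_mem_erase hk) x]
  have h0 := sum_weight_centred_mul θ μ i g hg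
  rw [← sub_zero (∑ x, _), ← h0, ← Finset.sum_sub_distrib, partitionFn, Finset.mul_sum]
  refine Finset.sum_le_sum fun x _ => ?_
  rw [← mul_sub, ← mul_sub, mul_comm _ (weight θ μ x)]
  refine mul_le_mul_of_nonneg_left ?_ (weight_pos θ μ x).le
  refine (le_abs_self _).trans ?_
  rw [abs_mul, mul_div_assoc]
  refine mul_le_mul (abs_centred_le x i _) ?_ (abs_nonneg _) (by norm_num)
  have e : localField θ x j + μ j = θ / n * spin x i +
      (θ / n * ∑ k ∈ (Finset.univ.erase j).erase i, spin x k + μ j) := by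
    rw [localField, ← Finset.add_sum_erase _ _ (Finset.mem_erase.2 ⟨hij, Finset.mem_univ i⟩)]
    ring
  simp only [hgdef]
  rw [sub_sub_sub_cancel_left, e, abs_sub_comm]
  refine (abs_tanh_sub_tanh_le _ _).trans ?_
  rw [add_sub_cancel_right, abs_mul, abs_spin, mul_one, abs_of_nonneg (by positivity)]

theorem sum_weight_centredSum_sq_le {θ : ℝ} (hθ : 0 ≤ θ) (μ : Fin n → ℝ) :
    ∑ x, weight θ μ x * centredSum θ μ x ^ 2 ≤ (4 + 2 * θ) * n * partitionFn θ μ := by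
  have hZ := partitionFn_pos θ μ
  have e : ∑ x, weight θ μ x * centredSum θ μ x ^ 2 = ∑ i, ∑ j, ∑ x,
      weight θ μ x * ((spin x i - Real.tanh (localField θ x i + μ i)) *
        (spin x j - Real.tanh (localField θ x j + μ j))) := by
    rw [Finset.sum_congr rfl fun i _ => Finset.sum_comm, Finset.sum_comm]
    refine Finset.sum_congr rfl fun x _ => ?_
    rw [centredSum, sq, Finset.sum_mul_sum, Finset.mul_sum]
    exact Finset.sum_congr rfl fun i _ => by rw [Finset.mul_sum]
  -- The off-diagonal bound is also added on the diagonal, so that the double sum is exactly `4 n +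
  -- n² * (2 θ / n)` times the partition function.
  have hb : ∀ i j : Fin n, ∑ x,
      weight θ μ x * ((spin x i - Real.tanh (localField θ x i + μ i)) *
        (spin x j - Real.tanh (localField θ x j + μ j))) ≤
      (if i = j then 4 * partitionFn θ μ else 0) + 2 * θ / n * partitionFn θ μ := by
    intro i j
    by_cases hij : i = j
    · subst hij
      have : ∑ x, weight θ μ x * ((spin x i - Real.tanh (localField θ x i + μ i)) *
        (spin x i - Real.tanh (localField θ x i + μ i))) ≤ 4 * partitionFn θ μ := by
        rw [partitionFn, Finset.mul_sum]
        refine Finset.sum_le_sum fun x _ => ?_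
        rw [mul_comm 4]
        refine mul_le_mul_of_nonneg_left ?_ (weight_pos θ μ x).le
        have := abs_le.1 (abs_centred_le x i (localField θ x i + μ i))
        nlinarith
      have h2 : 0 ≤ 2 * θ / n * partitionFn θ μ := by positivity
      simp only [if_true]
      linarith
    · simp only [hij, if_false, zero_add]
      exact sum_weight_centred_mul_centred_le hθ μ hij
  rw [e]
  refine (Finset.sum_le_sum fun i _ => Finset.sum_le_sum fun j _ => hb i j).trans ?_
  rcases Nat.eq_zero_or_pos n with rfl | hn
  · simp
  have hn' : (n : ℝ) ≠ 0 := by positivity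
  simp [Finset.sum_add_distrib]
  apply le_of_eq
  field_simp

/-- Chebyshev's inequality at scale `r √n`, valid under every field `μ`. -/
theorem prob_le_of_le_sq_centredSum {θ : ℝ} (hθ : 0 ≤ θ) (μ : Fin n → ℝ) (hn : 0 < n) {r : ℝ}
    (hr : 0 < r) {A : Set (Config n)} (hA : ∀ x ∈ A, r ^ 2 * n ≤ centredSum θ μ x ^ 2) :
    prob θ μ A ≤ (4 + 2 * θ) / r ^ 2 := by
  have hn' : (0 : ℝ) < n := by positivity
  rw [prob_eq_div, div_le_div_iff₀ (partitionFn_pos θ μ) (by positivity)]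
  refine le_of_mul_le_mul_right ?_ hn'
  calc (∑ x, A.indicator (weight θ μ) x) * r ^ 2 * n
      = ∑ x, A.indicator (weight θ μ) x * (r ^ 2 * n) := by
        simp_rw [Finset.sum_mul, mul_assoc]
    _ ≤ ∑ x, weight θ μ x * centredSum θ μ x ^ 2 := by
        refine Finset.sum_le_sum fun x _ => ?_
        have := weight_pos θ μ x
        by_cases hx : x ∈ A
        · rw [Set.indicator_of_mem hx]
          exact mul_le_mul_of_nonneg_left (hA x hx) this.le
        · rw [Set.indicator_of_notMem hx, zero_mul]
          positivity
    _ ≤ (4 + 2 * θ) * n * partitionFn θ μ := sum_weight_centredSum_sq_le hθ μ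
    _ = (4 + 2 * θ) * partitionFn θ μ * n := by ring

theorem centredSum_zero (θ : ℝ) (x : Config n) (hn : 0 < n) :
    centredSum θ 0 x = n * centredMean θ x := by
  have hn' : (n : ℝ) ≠ 0 := by positivity
  rw [centredMean, centredSum, ← mul_assoc, mul_one_div_cancel hn', one_mul]
  simp [localField]

theorem abs_localField_le {θ : ℝ} (hθ : 0 ≤ θ) (x : Config n) (i : Fin n) :
    |localField θ x i| ≤ θ := by
  have hn : (0 : ℝ) < n := by exact_mod_cast i.pos
  rw [localField, abs_mul, abs_of_nonneg (by positivity)]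
  have : |∑ j ∈ Finset.univ.erase i, spin x j| ≤ n := by
    refine (Finset.abs_sum_le_sum_abs _ _).trans ?_
    simp only [abs_spin]
    simp
  calc θ / n * |∑ j ∈ Finset.univ.erase i, spin x j| ≤ θ / n * n :=
        mul_le_mul_of_nonneg_left this (by positivity)
    _ = θ := by field_simp

/-- The two sums differ only at the `s` shifted sites. There the local field lies in `[-θ, θ]`, so
`tanh` has not saturated and `le_tanh_add_sub_tanh` applies. -/
theorem centredSum_add_le {θ : ℝ} (hθ : 0 ≤ θ) {s : ℕ} {B : ℝ} (hB : 0 < B) {μ : Fin n → ℝ}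
    (hμ : μ ∈ sparseAlt n s B) (x : Config n) :
    centredSum θ μ x + s * Real.tanh B * ((1 - Real.tanh θ ^ 2) / 2) ≤ centredSum θ 0 x := by
  classical
  obtain ⟨hs, hmin⟩ := hμ
  have hcard : (Finset.univ.filter fun i => μ i ≠ 0).card = s := by
    rw [← hs, ← Set.ncard_coe_finset]
    congr 1
    ext i
    simp
  set c := Real.tanh B * ((1 - Real.tanh θ ^ 2) / 2) with hc
  have e : s * Real.tanh B * ((1 - Real.tanh θ ^ 2) / 2) = ∑ i, if μ i ≠ 0 then c else 0 := by
    rw [← Finset.sum_filter, Finset.sum_const, hcard, nsmul_eq_mul, hc, mul_assoc]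
  rw [e, centredSum, centredSum, ← Finset.sum_add_distrib]
  refine Finset.sum_le_sum fun i _ => ?_
  by_cases hi : μ i = 0
  · simp [hi]
  · have h1 : B ≤ μ i := hmin i hi
    have h2 := le_tanh_add_sub_tanh (abs_localField_le hθ x i) hB.le
    have h3 := tanh_strictMono.monotone (add_le_add_right h1 (localField θ x i))
    simp only [Pi.zero_apply, add_zero, if_pos (show μ i ≠ 0 from hi), hc]
    linarith

theorem prob_zero_centredTest_le {θ : ℝ} (hθ : 0 ≤ θ) (hn : 0 < n) {L : ℝ} (hL : 0 < L) :
    prob θ 0 {x | centredTest θ L n x = 1} ≤ (4 + 2 * θ) / L ^ 2 := by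
  refine prob_le_of_le_sq_centredSum hθ 0 hn hL fun x hx => ?_
  have hx' : L ≤ √(n : ℝ) * centredMean θ x := by
    by_contra h
    simp [centredTest, h] at hx
  have hsq : √(n : ℝ) ^ 2 = n := Real.sq_sqrt (Nat.cast_nonneg n)
  rw [centredSum_zero θ x hn]
  calc L ^ 2 * n ≤ (√(n : ℝ) * centredMean θ x) ^ 2 * n := by gcongr
    _ = (n * centredMean θ x) ^ 2 := by rw [mul_pow, hsq]; ring

/-- If the signal exceeds the threshold with margin `r`, failing to reject forces `centredSum θ μ ≤
-r √n`. -/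
theorem prob_sparseAlt_centredTest_le {θ : ℝ} (hθ : 0 ≤ θ) (hn : 0 < n) {s : ℕ} {B L r : ℝ}
    (hB : 0 < B) (hr : 0 < r)
    (hLr : L + r ≤ (√(n : ℝ))⁻¹ * (s * Real.tanh B) * ((1 - Real.tanh θ ^ 2) / 2))
    {μ : Fin n → ℝ} (hμ : μ ∈ sparseAlt n s B) :
    prob θ μ {x | centredTest θ L n x = 0} ≤ (4 + 2 * θ) / r ^ 2 := by
  refine prob_le_of_le_sq_centredSum hθ μ hn hr fun x hx => ?_
  have hx' : √(n : ℝ) * centredMean θ x < L := by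
    by_contra h
    rw [Set.mem_ofPred_eq, centredTest, if_pos (not_lt.1 h)] at hx
    exact one_ne_zero hx
  have hn' : (0 : ℝ) < n := by positivity
  have hsq : √(n : ℝ) * √(n : ℝ) = n := Real.mul_self_sqrt (Nat.cast_nonneg n)
  have hpos : 0 < √(n : ℝ) := Real.sqrt_pos.2 hn'
  have h := centredSum_add_le hθ hB hμ x
  rw [centredSum_zero θ x hn, ← hsq] at h
  have h2 := mul_le_mul_of_nonneg_left hLr hpos.le
  have h3 : √(n : ℝ) * ((√(n : ℝ))⁻¹ * (s * Real.tanh B) * ((1 - Real.tanh θ ^ 2) / 2)) =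
      s * Real.tanh B * ((1 - Real.tanh θ ^ 2) / 2) := by
    field_simp
  rw [h3] at h2
  have h4 := mul_lt_mul_of_pos_left hx' hpos
  have h5 : √(n : ℝ) * r ≤ -centredSum θ μ x := by nlinarith
  calc r ^ 2 * n = (√(n : ℝ) * r) ^ 2 := by rw [mul_pow, sq √(n : ℝ), hsq]; ring
    _ ≤ (-centredSum θ μ x) ^ 2 := by gcongr
    _ = centredSum θ μ x ^ 2 := by ring

/-! ### The risk -/

theorem risk_nonneg (θ : ℝ) (s : ℕ) (B : ℝ) (T : Test n) : 0 ≤ risk θ s B T :=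
  add_nonneg (prob_nonneg _ _ _) (Real.iSup_nonneg fun _ => prob_nonneg _ _ _)

theorem risk_le_two (θ : ℝ) (s : ℕ) (B : ℝ) (T : Test n) : risk θ s B T ≤ 2 := by
  have h1 := prob_le_one θ 0 {x | T x = 1}
  -- The side goal `0 ≤ 1` covers an empty alternative, where the real supremum is `0` by default.
  have h2 : ⨆ μ : sparseAlt n s B, prob θ (μ : Fin n → ℝ) {x | T x = 0} ≤ 1 :=
    Real.iSup_le (fun _ => prob_le_one _ _ _) zero_le_one
  unfold risk
  linarith

theorem prob_le_iSup (θ : ℝ) {s : ℕ} {B : ℝ} (T : Test n) {μ : Fin n → ℝ}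
    (hμ : μ ∈ sparseAlt n s B) : prob θ μ {x | T x = 0} ≤
      ⨆ μ : sparseAlt n s B, prob θ (μ : Fin n → ℝ) {x | T x = 0} :=
  le_ciSup (f := fun μ : sparseAlt n s B => prob θ (μ : Fin n → ℝ) {x | T x = 0})
    ⟨1, by rintro _ ⟨_, rfl⟩; exact prob_le_one _ _ _⟩ ⟨μ, hμ⟩

theorem asymptoticallyPowerful_iff {θ : ℝ} {s : ℕ → ℕ} {B : ℕ → ℝ} {T : ∀ n, Test n} :
    AsymptoticallyPowerful θ s B T ↔
      Tendsto (fun n => risk θ (s n) (B n) (T n)) atTop (nhds 0) := by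
  have hlo : ∀ n, 0 ≤ risk θ (s n) (B n) (T n) := fun n => risk_nonneg _ _ _ _
  have hbd : IsBoundedUnder (· ≤ ·) atTop fun n => risk θ (s n) (B n) (T n) :=
    isBoundedUnder_of ⟨2, fun n => risk_le_two _ _ _ _⟩
  refine ⟨fun h => ?_, fun h => h.limsup_eq⟩
  rw [Metric.tendsto_nhds]
  intro ε hε
  have := eventually_lt_of_limsup_lt (lt_of_eq_of_lt h hε) hbd
  filter_upwards [this] with n hn
  rw [Real.dist_eq, sub_zero, abs_of_nonneg (hlo n)]
  exact hn

theorem tendsto_signal {s : ℕ → ℕ} {B : ℕ → ℝ} (hB : ∀ n, 0 < B n)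
    (h : (fun n : ℕ => √(n : ℝ)) =o[atTop] (fun n => (s n : ℝ) * Real.tanh (B n))) :
    Tendsto (fun n : ℕ => (√(n : ℝ))⁻¹ * ((s n : ℝ) * Real.tanh (B n))) atTop atTop := by
  rw [tendsto_atTop]
  intro b
  have hb : (0 : ℝ) < (|b| + 1)⁻¹ := by positivity
  filter_upwards [h.bound hb, eventually_gt_atTop 0] with n hn hpos
  have h0 : 0 < √(n : ℝ) := Real.sqrt_pos.2 (by positivity)
  have h1 : 0 ≤ (s n : ℝ) * Real.tanh (B n) := mul_nonneg (by positivity) (tanh_pos (hB n)).le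
  rw [Real.norm_of_nonneg h0.le, Real.norm_of_nonneg h1, ← div_eq_inv_mul,
    le_div_iff₀ (by positivity)] at hn
  rw [← div_eq_inv_mul, le_div_iff₀ h0]
  nlinarith [le_abs_self b]

theorem asymptoticallyPowerful_centredTest {θ : ℝ} (hθ : 0 ≤ θ) {s : ℕ → ℕ} {B : ℕ → ℝ}
    (hB : ∀ n, 0 < B n)
    (h : (fun n : ℕ => √(n : ℝ)) =o[atTop] (fun n => (s n : ℝ) * Real.tanh (B n))) {L : ℕ → ℝ}
    (hL : Tendsto L atTop atTop)
    (hLo : L =o[atTop] (fun n => (√(n : ℝ))⁻¹ * ((s n : ℝ) * Real.tanh (B n)))) :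
    AsymptoticallyPowerful θ s B (fun n => centredTest θ (L n) n) := by
  rw [asymptoticallyPowerful_iff]
  set a : ℕ → ℝ := fun n => (√(n : ℝ))⁻¹ * ((s n : ℝ) * Real.tanh (B n)) with ha
  have hat : Tendsto a atTop atTop := tendsto_signal hB h
  set c := (1 - Real.tanh θ ^ 2) / 2 with hc
  have hc0 : 0 < c := by have := Real.tanh_sq_lt_one θ; rw [hc]; linarith
  have lim : Tendsto (fun n => (4 + 2 * θ) / L n ^ 2 + (4 + 2 * θ) / (a n * (c / 2)) ^ 2)
      atTop (nhds 0) := by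
    have h1 := ((tendsto_pow_atTop two_ne_zero).comp hL).const_div_atTop (4 + 2 * θ)
    have h2 := ((tendsto_pow_atTop two_ne_zero).comp
      (hat.atTop_mul_const (half_pos hc0))).const_div_atTop (4 + 2 * θ)
    simpa using h1.add h2
  refine squeeze_zero' (Eventually.of_forall fun n => risk_nonneg _ _ _ _) ?_ lim
  -- Of the drift `a n * c`, one half dominates the threshold `L n` and the other half is left as
  -- the margin `r`.
  filter_upwards [hLo.bound (half_pos hc0), hat.eventually_gt_atTop 0, hL.eventually_gt_atTop 0,
    eventually_gt_atTop 0] with n hn hapos hLpos hnpos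
  rw [Real.norm_of_nonneg hLpos.le, Real.norm_of_nonneg hapos.le] at hn
  refine add_le_add (prob_zero_centredTest_le hθ hnpos hLpos) ?_
  refine Real.iSup_le (fun μ => ?_) (by positivity)
  refine prob_sparseAlt_centredTest_le hθ hnpos (hB n) (by positivity) ?_ μ.2
  change _ ≤ a n * c
  linarith

theorem exists_threshold {s : ℕ → ℕ} {B : ℕ → ℝ} (hB : ∀ n, 0 < B n)
    (h : (fun n : ℕ => √(n : ℝ)) =o[atTop] (fun n => (s n : ℝ) * Real.tanh (B n))) :
    ∃ L : ℕ → ℝ, Tendsto L atTop atTop ∧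
      L =o[atTop] (fun n => (√(n : ℝ))⁻¹ * ((s n : ℝ) * Real.tanh (B n))) := by
  have hat := tendsto_signal hB h
  have hs : Tendsto (fun n : ℕ => √((√(n : ℝ))⁻¹ * ((s n : ℝ) * Real.tanh (B n)))) atTop atTop :=
    Real.tendsto_sqrt_atTop.comp hat
  refine ⟨_, hs, ?_⟩
  rw [isLittleO_iff]
  intro ε hε
  filter_upwards [hs.eventually_ge_atTop ε⁻¹, hat.eventually_ge_atTop 0] with n hn hpos
  rw [Real.norm_of_nonneg (Real.sqrt_nonneg _), Real.norm_of_nonneg hpos]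
  have h1 := Real.mul_self_sqrt hpos
  set r := √((√(n : ℝ))⁻¹ * ((s n : ℝ) * Real.tanh (B n)))
  rw [← h1]
  have h2 : 1 ≤ ε * r := by
    rw [inv_le_iff_one_le_mul₀ hε] at hn
    linarith
  nlinarith [Real.sqrt_nonneg ((√(n : ℝ))⁻¹ * ((s n : ℝ) * Real.tanh (B n)))]

/-! ### The mean-field rate function -/

/-- This is where supercriticality enters: `θ tanh a ≥ a` once `cosh a < θ`, while `θ tanh θ ≤ θ`,
so the intermediate value theorem gives a nonzero magnetisation. -/
theorem exists_pos_eq_mul_tanh {θ : ℝ} (hθ : 1 < θ) : ∃ r, 0 < r ∧ r = θ * Real.tanh r := by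
  obtain ⟨a, ha, hac⟩ : ∃ a : ℝ, 0 < a ∧ Real.cosh a < θ := by
    have h : ∀ᶠ x in nhdsWithin (0 : ℝ) (Set.Ioi 0), Real.cosh x < θ :=
      (Real.continuous_cosh.tendsto' 0 1 Real.cosh_zero).eventually_lt_const hθ
        |>.filter_mono nhdsWithin_le_nhds
    obtain ⟨a, ha⟩ := (h.and self_mem_nhdsWithin).exists
    exact ⟨a, ha.2, ha.1⟩
  have h1 : a ≤ θ * Real.tanh a := by
    have h2 := Real.self_le_sinh_iff.2 ha.le
    have h3 := Real.cosh_pos a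
    rw [Real.tanh_eq_sinh_div_cosh, mul_div_assoc', le_div_iff₀ h3]
    nlinarith
  have h4 : θ * Real.tanh θ ≤ θ := by nlinarith [Real.tanh_lt_one θ]
  have h5 : a ≤ θ := by nlinarith [Real.tanh_lt_one a]
  have hc : ContinuousOn (fun x => x - θ * Real.tanh x) (Set.Icc a θ) :=
    (continuous_id.sub (continuous_const.mul continuous_tanh)).continuousOn
  obtain ⟨r, hr, hr0⟩ := intermediate_value_Icc h5 hc
    (show (0 : ℝ) ∈ _ from ⟨by linarith, by linarith⟩)
  exact ⟨r, ha.trans_le hr.1, by simp only at hr0; linarith⟩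

theorem concaveOn_tanh : ConcaveOn ℝ (Set.Ici 0) Real.tanh := by
  refine AntitoneOn.concaveOn_of_deriv (convex_Ici 0) continuous_tanh.continuousOn
    differentiable_tanh.differentiableOn ?_
  intro x hx y hy hxy
  rw [interior_Ici, Set.mem_Ioi] at hx hy
  rw [deriv_tanh, deriv_tanh]
  have := tanh_strictMono.monotone hxy
  have := tanh_pos hx
  nlinarith

/-- The rate function of the field in the Hubbard-Stratonovich representation. -/
noncomputable def rate (θ h : ℝ) : ℝ := h ^ 2 / (2 * θ) - Real.log (Real.cosh h)

theorem hasDerivAt_rate (θ h : ℝ) : HasDerivAt (rate θ) (h / θ - Real.tanh h) h := by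
  have h1 := ((hasDerivAt_pow 2 h).div_const (2 * θ)).sub
    ((Real.hasDerivAt_cosh h).log (Real.cosh_pos h).ne')
  refine h1.congr_deriv ?_
  rw [Real.tanh_eq_sinh_div_cosh]
  congr 1
  rw [show ((2 : ℕ) : ℝ) * h ^ (2 - 1) = 2 * h by norm_num, mul_div_mul_left _ _ two_ne_zero]

theorem continuous_rate (θ : ℝ) : Continuous (rate θ) :=
  continuous_iff_continuousAt.2 fun h => (hasDerivAt_rate θ h).continuousAt

theorem rate_abs (θ h : ℝ) : rate θ |h| = rate θ h := by
  rw [rate, rate, sq_abs, Real.cosh_abs]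

theorem hasDerivAt_rate_sub_sq (θ c r h : ℝ) :
    HasDerivAt (fun x => rate θ x - c * (x - r) ^ 2) (h / θ - Real.tanh h - 2 * c * (h - r)) h := by
  have h1 := (hasDerivAt_rate θ h).sub ((((hasDerivAt_id h).sub_const r).pow 2).const_mul c)
  refine h1.congr_deriv ?_
  simp
  ring

/-- A critical point `r` of the rate function gives a quadratic upper bound to its right. -/
theorem rate_le_add_sq {θ r : ℝ} (hr : r / θ = Real.tanh r) {h : ℝ}
    (hh : r ≤ h) : rate θ h ≤ rate θ r + (h - r) ^ 2 / (2 * θ) := by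
  have hd := hasDerivAt_rate_sub_sq θ (1 / (2 * θ)) r
  have h1 : AntitoneOn (fun x => rate θ x - 1 / (2 * θ) * (x - r) ^ 2) (Set.Ici r) := by
    refine antitoneOn_of_deriv_nonpos (convex_Ici r)
      (fun x _ => (hd x).continuousAt.continuousWithinAt)
      (fun x _ => (hd x).differentiableAt.differentiableWithinAt) fun x hx => ?_
    rw [interior_Ici, Set.mem_Ioi] at hx
    rw [(hd x).deriv]
    have := tanh_strictMono.monotone hx.le
    have e : 2 * (1 / (2 * θ)) * (x - r) = x / θ - r / θ := by
      rcases eq_or_ne θ 0 with rfl | h0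
      · simp
      · field_simp
    linarith
  have h2 := h1 (Set.mem_Ici.2 le_rfl) (Set.mem_Ici.2 hh) hh
  simp only [sub_self] at h2
  have e : (h - r) ^ 2 / (2 * θ) = 1 / (2 * θ) * (h - r) ^ 2 := by ring
  rw [e]
  linarith

/-- The chord of `tanh` over `[r / 2, r]` has slope `k < 1 / θ`. By concavity `tanh` lies above this
chord on the interval and below its extension beyond `r`. With `c = (1 / θ - k) / 2`, the derivative
of `rate - c (h - r)²` is chord minus `tanh`, so it changes sign at `r`. -/
theorem exists_rate_ge_add_sq {θ r : ℝ} (hr0 : 0 < r) (hr : r / θ = Real.tanh r) :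
    ∃ c, 0 < c ∧ ∀ h, rate θ r + c * (|h| - r) ^ 2 ≤ rate θ h := by
  set a := r / 2 with ha
  have ha0 : 0 < a := by positivity
  have hra : r = a + a := by rw [ha]; ring
  have ht : Real.tanh r < 2 * Real.tanh a := by
    have h1 := tanh_pos ha0
    rw [hra, tanh_add, div_lt_iff₀ (by positivity)]
    nlinarith [mul_pos h1 (mul_pos h1 h1)]
  set k := (Real.tanh r - Real.tanh a) / a with hk
  have hka : k * a = Real.tanh r - Real.tanh a := by rw [hk]; field_simp
  have hk1 : k < 1 / θ := by
    have e : r / θ = 1 / θ * (2 * a) := by rw [hra]; ring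
    rw [e] at hr
    by_contra hcon
    have := mul_le_mul_of_nonneg_right (not_lt.1 hcon) ha0.le
    linarith
  set c := (1 / θ - k) / 2 with hc
  have hc0 : 0 < c := by rw [hc]; linarith
  have hright : ∀ h, r ≤ h → Real.tanh h ≤ Real.tanh r + k * (h - r) := by
    intro h hh
    rcases hh.eq_or_lt with rfl | hlt
    · simp
    have := concaveOn_tanh.slope_anti_adjacent (x := a) (y := r) (z := h) ha0.le
      (hr0.le.trans hh) (by linarith) hlt
    rw [show r - a = a by linarith, ← hk, div_le_iff₀ (by linarith)] at this
    linarith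
  have hleft : ∀ h, a ≤ h → h ≤ r → Real.tanh r + k * (h - r) ≤ Real.tanh h := by
    intro h hah hhr
    rcases hah.eq_or_lt with rfl | hlt
    · rw [show a - r = -a by linarith]
      linarith
    rcases hhr.eq_or_lt with rfl | hlt2
    · simp
    have := concaveOn_tanh.slope_anti_adjacent (x := a) (y := h) (z := r) ha0.le
      hr0.le hlt hlt2
    rw [div_le_div_iff₀ (by linarith) (by linarith)] at this
    have e : (Real.tanh r - Real.tanh h) * a ≤ k * (r - h) * a := by
      have e1 : (Real.tanh r - Real.tanh h) * (r - a) ≤ (Real.tanh r - Real.tanh a) * (r - h) := by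
        linarith
      rw [← hka, show r - a = a by linarith] at e1
      linarith
    have := le_of_mul_le_mul_right e ha0
    linarith
  have hd := hasDerivAt_rate_sub_sq θ c r
  have hder : ∀ h, h / θ - Real.tanh h - 2 * c * (h - r) =
      Real.tanh r + k * (h - r) - Real.tanh h := by
    intro h
    rw [← hr, hc]
    ring
  have mright : MonotoneOn (fun x => rate θ x - c * (x - r) ^ 2) (Set.Ici r) := by
    refine monotoneOn_of_deriv_nonneg (convex_Ici r)
      (fun x _ => (hd x).continuousAt.continuousWithinAt)
      (fun x _ => (hd x).differentiableAt.differentiableWithinAt) fun x hx => ?_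
    rw [interior_Ici, Set.mem_Ioi] at hx
    rw [(hd x).deriv, hder]
    linarith [hright x hx.le]
  have mleft : AntitoneOn (fun x => rate θ x - c * (x - r) ^ 2) (Set.Icc a r) := by
    refine antitoneOn_of_deriv_nonpos (convex_Icc a r)
      (fun x _ => (hd x).continuousAt.continuousWithinAt)
      (fun x _ => (hd x).differentiableAt.differentiableWithinAt) fun x hx => ?_
    rw [interior_Icc] at hx
    rw [(hd x).deriv, hder]
    linarith [hleft x hx.1.le hx.2.le]
  have manti : AntitoneOn (rate θ) (Set.Icc 0 a) := by
    refine antitoneOn_of_deriv_nonpos (convex_Icc 0 a) (continuous_rate θ).continuousOn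
      (fun x _ => (hasDerivAt_rate θ x).differentiableAt.differentiableWithinAt) fun x hx => ?_
    rw [interior_Icc] at hx
    rw [(hasDerivAt_rate θ x).deriv]
    have := concaveOn_tanh.slope_anti_adjacent (x := 0) (y := x) (z := r) (Set.mem_Ici.2 le_rfl)
      hr0.le hx.1 (by linarith [hx.2])
    rw [div_le_div_iff₀ (by linarith [hx.2]) (by linarith [hx.1]), Real.tanh_zero, ← hr] at this
    have e : x / θ * r ≤ Real.tanh x * r := by
      have : x / θ * r = r / θ * x := by ring
      nlinarith
    linarith [le_of_mul_le_mul_right e hr0]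
  have ge : ∀ h, a ≤ h → rate θ r + c * (h - r) ^ 2 ≤ rate θ h := by
    intro h hah
    rcases le_total r h with hh | hh
    · have := mright (Set.mem_Ici.2 le_rfl) (Set.mem_Ici.2 hh) hh
      simp only [sub_self] at this
      linarith
    · have := mleft (Set.mem_Icc.2 ⟨hah, hh⟩) (Set.mem_Icc.2 ⟨by linarith, le_rfl⟩) hh
      simp only [sub_self] at this
      linarith
  -- On `[0, a]` the rate is only known to decrease to its value at `a = r / 2`. There `(|h| - r)² ≤
  -- r² = 4 (a - r)²`, which costs the factor `4`.
  refine ⟨c / 4, by positivity, fun h => ?_⟩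
  rw [← rate_abs θ h]
  rcases le_total a |h| with hh | hh
  · have := ge |h| hh
    nlinarith [mul_nonneg hc0.le (sq_nonneg (|h| - r))]
  · have h1 := ge a le_rfl
    have h2 := manti ⟨abs_nonneg h, hh⟩ ⟨ha0.le, le_rfl⟩ hh
    have h3 : (|h| - r) ^ 2 ≤ 4 * (a - r) ^ 2 := by nlinarith [abs_nonneg h]
    nlinarith

/-! ### Laplace estimates for the mixing density -/

/-- The unnormalised density of the field `h` given which the spins are independent under the
null hypothesis. -/
noncomputable def fieldDensity (θ : ℝ) (n : ℕ) (h : ℝ) : ℝ :=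
  Real.exp (-(n / (2 * θ)) * h ^ 2) * (2 * Real.cosh h) ^ n

theorem fieldDensity_pos (θ : ℝ) (n : ℕ) (h : ℝ) : 0 < fieldDensity θ n h :=
  mul_pos (Real.exp_pos _) (pow_pos (mul_pos two_pos (Real.cosh_pos h)) n)

theorem continuous_fieldDensity (θ : ℝ) (n : ℕ) : Continuous (fieldDensity θ n) := by
  unfold fieldDensity
  have := Real.continuous_cosh
  fun_prop

theorem fieldDensity_eq (θ : ℝ) (n : ℕ) (h : ℝ) :
    fieldDensity θ n h = 2 ^ n * Real.exp (-(n * rate θ h)) := by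
  have h1 : Real.cosh h ^ n = Real.exp (n * Real.log (Real.cosh h)) := by
    rw [Real.exp_nat_mul, Real.exp_log (Real.cosh_pos h)]
  rw [fieldDensity, mul_pow, h1, mul_left_comm, ← Real.exp_add, rate]
  congr 2
  ring

/-- The order of magnitude of the integral of `fieldDensity` near a minimiser `r` of the rate. -/
noncomputable def laplaceScale (θ r : ℝ) (n : ℕ) : ℝ :=
  2 ^ n * Real.exp (-(n * rate θ r)) * (√(n : ℝ))⁻¹

theorem laplaceScale_pos (θ r : ℝ) {n : ℕ} (hn : 0 < n) : 0 < laplaceScale θ r n := by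
  unfold laplaceScale
  positivity

/-- On a window of width `n^(-1/2)` to the right of `r`, `n * rate` rises by at most `1 / (2 θ)`. -/
theorem laplaceScale_le_setIntegral {θ r : ℝ} (hθ : 0 < θ) (hr : r / θ = Real.tanh r) {n : ℕ}
    (hn : 0 < n) : Real.exp (-(1 / (2 * θ))) * laplaceScale θ r n ≤
      ∫ h in Set.Icc r (r + (√(n : ℝ))⁻¹), fieldDensity θ n h := by
  have hn' : (0 : ℝ) < n := by positivity
  have hs : 0 < (√(n : ℝ))⁻¹ := by positivity
  have h1 : ∫ _ in Set.Icc r (r + (√(n : ℝ))⁻¹),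
      Real.exp (-(1 / (2 * θ))) * (2 ^ n * Real.exp (-(n * rate θ r))) =
      Real.exp (-(1 / (2 * θ))) * laplaceScale θ r n := by
    rw [MeasureTheory.setIntegral_const, MeasureTheory.measureReal_def, Real.volume_Icc,
      add_sub_cancel_left, ENNReal.toReal_ofReal hs.le, smul_eq_mul, laplaceScale]
    ring
  rw [← h1]
  refine MeasureTheory.setIntegral_mono_on
    (continuous_const.integrableOn_Icc)
    ((continuous_fieldDensity θ n).integrableOn_Icc) measurableSet_Icc fun h hh => ?_
  rw [fieldDensity_eq, mul_left_comm, ← Real.exp_add]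
  gcongr
  have h2 := rate_le_add_sq hr hh.1
  have h3 : (h - r) ^ 2 ≤ (√(n : ℝ))⁻¹ ^ 2 :=
    pow_le_pow_left₀ (by linarith [hh.1]) (by linarith [hh.2]) 2
  rw [inv_pow, Real.sq_sqrt hn'.le] at h3
  have h4 : n * ((h - r) ^ 2 / (2 * θ)) ≤ 1 / (2 * θ) := by
    rw [mul_div_assoc']
    gcongr
    calc n * (h - r) ^ 2 ≤ n * (n : ℝ)⁻¹ := by gcongr
      _ = 1 := by field_simp
  nlinarith

/-- Measuring the distance by `|h| - r` treats both wells at once: for negative `h` the left side is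
only smaller. -/
theorem one_add_mul_tanh_pow_le {r τ y : ℝ} {s : ℕ} (hr : 0 ≤ r) (hτ : 0 ≤ τ) (hτ1 : τ ≤ 1)
    (hC : s * τ ≤ y) (h : ℝ) :
    (1 + τ * Real.tanh h) ^ s ≤ (1 + τ * Real.tanh r) ^ s * Real.exp (y * |(|h| - r)|) := by
  have hm : 0 ≤ Real.tanh r := by simpa using tanh_strictMono.monotone hr
  have h0 : 0 ≤ 1 + τ * Real.tanh h := by nlinarith [Real.neg_one_lt_tanh h]
  have h1 : Real.tanh h - Real.tanh r ≤ |(|h| - r)| :=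
    (sub_le_sub_right (tanh_strictMono.monotone (le_abs_self h)) _).trans
      ((le_abs_self _).trans (abs_tanh_sub_tanh_le |h| r))
  have h2 : 1 + τ * Real.tanh h ≤ (1 + τ * Real.tanh r) * Real.exp (τ * |(|h| - r)|) := by
    have h3 := Real.add_one_le_exp (τ * |(|h| - r)|)
    have h4 : 1 + τ * Real.tanh h ≤ (1 + τ * Real.tanh r) * (τ * |(|h| - r)| + 1) := by
      have := mul_le_mul_of_nonneg_left h1 hτ
      have : 0 ≤ τ * Real.tanh r * (τ * |(|h| - r)|) := by positivity
      nlinarith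
    exact h4.trans (by gcongr)
  calc (1 + τ * Real.tanh h) ^ s ≤ ((1 + τ * Real.tanh r) * Real.exp (τ * |(|h| - r)|)) ^ s := by
        gcongr
    _ = (1 + τ * Real.tanh r) ^ s * Real.exp (s * τ * |(|h| - r)|) := by
        rw [mul_pow, ← Real.exp_nat_mul, mul_assoc]
    _ ≤ _ := by gcongr

theorem integrable_gaussian_shift {b : ℝ} (hb : 0 < b) (a : ℝ) :
    MeasureTheory.Integrable fun h : ℝ => Real.exp (-b * (h - a) ^ 2) :=
  (integrable_exp_neg_mul_sq hb).comp_sub_right a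

theorem integral_gaussian_shift (b a : ℝ) :
    ∫ h : ℝ, Real.exp (-b * (h - a) ^ 2) = √(Real.pi / b) := by
  rw [MeasureTheory.integral_sub_right_eq_self (fun h : ℝ => Real.exp (-b * h ^ 2)) a,
    integral_gaussian]

/-- With `y` the distance of `|h|` from `r`, half of the quadratic well absorbs the tilt: `C √n y ≤
C² / (2 c) + n (c / 2) y²`. The other half remains as a Gaussian around each of `±r`. -/
theorem fieldDensity_mul_le {θ r c C : ℝ} (hr : 0 ≤ r) (hc : 0 < c)
    (hrate : ∀ h, rate θ r + c * (|h| - r) ^ 2 ≤ rate θ h) {n s : ℕ} {τ : ℝ}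
    (hτ : 0 ≤ τ) (hτ1 : τ ≤ 1) (hs : s * τ ≤ C * √(n : ℝ)) (h : ℝ) :
    fieldDensity θ n h * (1 + τ * Real.tanh h) ^ s ≤
      2 ^ n * Real.exp (-(n * rate θ r)) * (1 + τ * Real.tanh r) ^ s *
        Real.exp (C ^ 2 / (2 * c)) *
        (Real.exp (-(n * (c / 2)) * (h - r) ^ 2) + Real.exp (-(n * (c / 2)) * (h - -r) ^ 2)) := by
  have hm : 0 ≤ Real.tanh r := by simpa using tanh_strictMono.monotone hr
  have h1 := one_add_mul_tanh_pow_le hr hτ hτ1 hs h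
  set y := |(|h| - r)| with hy
  have hy2 : (|h| - r) ^ 2 = y ^ 2 := (sq_abs _).symm
  have hsq : √(n : ℝ) ^ 2 = n := Real.sq_sqrt (Nat.cast_nonneg n)
  have h2 : Real.exp (-(n * (c / 2)) * y ^ 2) ≤
      Real.exp (-(n * (c / 2)) * (h - r) ^ 2) + Real.exp (-(n * (c / 2)) * (h - -r) ^ 2) := by
    rw [← hy2]
    rcases abs_cases h with ⟨e, _⟩ | ⟨e, _⟩ <;> rw [e]
    · exact le_add_of_nonneg_right (Real.exp_pos _).le
    · rw [show (-h - r) ^ 2 = (h - -r) ^ 2 by ring]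
      exact le_add_of_nonneg_left (Real.exp_pos _).le
  have h3 : -(n * rate θ h) + C * √(n : ℝ) * y ≤
      -(n * rate θ r) + C ^ 2 / (2 * c) + -(n * (c / 2)) * y ^ 2 := by
    have e1 : C * √(n : ℝ) * y ≤ C ^ 2 / (2 * c) + n * (c / 2) * y ^ 2 := by
      have : 0 ≤ (C - c * √(n : ℝ) * y) ^ 2 / (2 * c) := by positivity
      have e : (C - c * √(n : ℝ) * y) ^ 2 / (2 * c) =
        C ^ 2 / (2 * c) + n * (c / 2) * y ^ 2 - C * √(n : ℝ) * y := by
        rw [sub_sq, mul_pow, mul_pow, hsq]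
        field_simp
        ring
      linarith
    have e2 := mul_le_mul_of_nonneg_left (hrate h) (Nat.cast_nonneg (α := ℝ) n)
    rw [hy2] at e2
    nlinarith
  have hb : 0 ≤ (1 + τ * Real.tanh r) ^ s := by positivity
  calc fieldDensity θ n h * (1 + τ * Real.tanh h) ^ s
      ≤ fieldDensity θ n h * ((1 + τ * Real.tanh r) ^ s * Real.exp (C * √(n : ℝ) * y)) :=
        mul_le_mul_of_nonneg_left h1 (fieldDensity_pos θ n h).le
    _ = 2 ^ n * (1 + τ * Real.tanh r) ^ s * Real.exp (-(n * rate θ h) + C * √(n : ℝ) * y) := by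
        rw [fieldDensity_eq, Real.exp_add]
        ring
    _ ≤ 2 ^ n * (1 + τ * Real.tanh r) ^ s *
          Real.exp (-(n * rate θ r) + C ^ 2 / (2 * c) + -(n * (c / 2)) * y ^ 2) := by gcongr
    _ = 2 ^ n * Real.exp (-(n * rate θ r)) * (1 + τ * Real.tanh r) ^ s *
        Real.exp (C ^ 2 / (2 * c)) * Real.exp (-(n * (c / 2)) * y ^ 2) := by
        rw [Real.exp_add, Real.exp_add]
        ring
    _ ≤ _ := by gcongr

theorem integral_fieldDensity_mul_le {θ r c C : ℝ} (hr : 0 ≤ r) (hc : 0 < c)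
    (hrate : ∀ h, rate θ r + c * (|h| - r) ^ 2 ≤ rate θ h) {n s : ℕ} (hn : 0 < n) {τ : ℝ}
    (hτ : 0 ≤ τ) (hτ1 : τ ≤ 1) (hs : s * τ ≤ C * √(n : ℝ)) :
    ∫ h, fieldDensity θ n h * (1 + τ * Real.tanh h) ^ s ≤
      2 * √(2 * Real.pi / c) * Real.exp (C ^ 2 / (2 * c)) *
        (laplaceScale θ r n * (1 + τ * Real.tanh r) ^ s) := by
  have hn' : (0 : ℝ) < n := by positivity
  have hb : 0 < n * (c / 2) := by positivity
  have i1 := integrable_gaussian_shift hb r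
  have i2 := integrable_gaussian_shift hb (-r)
  refine (MeasureTheory.integral_mono_of_nonneg (Eventually.of_forall fun h => ?_)
    ((i1.add i2).const_mul _)
    (Eventually.of_forall (fieldDensity_mul_le hr hc hrate hτ hτ1 hs))).trans (le_of_eq ?_)
  · have : 0 ≤ 1 + τ * Real.tanh h := by nlinarith [Real.neg_one_lt_tanh h]
    have := fieldDensity_pos θ n h
    simp only [Pi.zero_apply]
    positivity
  · simp only [Pi.add_apply]
    rw [MeasureTheory.integral_const_mul, MeasureTheory.integral_add i1 i2,
      integral_gaussian_shift, integral_gaussian_shift,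
      show Real.pi / (n * (c / 2)) = 2 * Real.pi / c / n by field_simp,
      Real.sqrt_div (by positivity) (n : ℝ), laplaceScale]
    ring

/-! ### Independent spins with a common mean -/

/-- The law of `n` independent spins with mean `t`. -/
noncomputable def iidSpin (t : ℝ) (x : Config n) : ℝ := ∏ i, (1 + t * spin x i) / 2

/-- Expectation with respect to `iidSpin`. -/
noncomputable def iidMean (t : ℝ) (f : Config n → ℝ) : ℝ := ∑ x, iidSpin t x * f x

theorem one_add_mul_spin_nonneg {t : ℝ} (ht : |t| ≤ 1) (x : Config n) (i : Fin n) :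
    0 ≤ 1 + t * spin x i := by
  have := abs_le.1 ht
  rcases spin_eq_or x i with h | h <;> rw [h] <;> linarith

theorem iidSpin_nonneg {t : ℝ} (ht : |t| ≤ 1) (x : Config n) : 0 ≤ iidSpin t x :=
  Finset.prod_nonneg fun i _ => div_nonneg (one_add_mul_spin_nonneg ht x i) zero_le_two

theorem iidMean_mono {t : ℝ} (ht : |t| ≤ 1) {f g : Config n → ℝ} (h : ∀ x, f x ≤ g x) :
    iidMean t f ≤ iidMean t g :=
  Finset.sum_le_sum fun x _ => mul_le_mul_of_nonneg_left (h x) (iidSpin_nonneg ht x)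

theorem iidMean_nonneg {t : ℝ} (ht : |t| ≤ 1) {f : Config n → ℝ} (h : ∀ x, 0 ≤ f x) :
    0 ≤ iidMean t f :=
  Finset.sum_nonneg fun x _ => mul_nonneg (iidSpin_nonneg ht x) (h x)

theorem iidMean_add (t : ℝ) (f g : Config n → ℝ) :
    iidMean t (fun x => f x + g x) = iidMean t f + iidMean t g := by
  simp only [iidMean, mul_add, Finset.sum_add_distrib]

theorem iidMean_const_mul (t a : ℝ) (f : Config n → ℝ) :
    iidMean t (fun x => a * f x) = a * iidMean t f := by
  simp only [iidMean, Finset.mul_sum, mul_left_comm]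

theorem iidMean_sum {ι : Type*} (t : ℝ) (S : Finset ι) (f : ι → Config n → ℝ) :
    iidMean t (fun x => ∑ a ∈ S, f a x) = ∑ a ∈ S, iidMean t (f a) := by
  simp only [iidMean, Finset.mul_sum]
  exact Finset.sum_comm

theorem iidMean_prod (t : ℝ) (g : Fin n → ℝ → ℝ) :
    iidMean t (fun x => ∏ i, g i (spin x i)) =
      ∏ i, ((1 + t) / 2 * g i 1 + (1 - t) / 2 * g i (-1)) := by
  have h : ∀ i, (1 + t) / 2 * g i 1 + (1 - t) / 2 * g i (-1) =
      ∑ u : ℤˣ, (1 + t * ((u : ℤ) : ℝ)) / 2 * g i ((u : ℤ) : ℝ) := by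
    intro i
    rw [UnitsInt.univ, Finset.sum_pair (by decide)]
    simp [sub_eq_add_neg]
  simp_rw [h]
  rw [Finset.prod_univ_sum, Fintype.piFinset_univ]
  simp only [iidMean, iidSpin, ← Finset.prod_mul_distrib]
  rfl

/-- The likelihood ratio, up to normalisation, of a shift of the field on the set `S`. -/
noncomputable def spikeProd (τ : ℝ) (S : Finset (Fin n)) (x : Config n) : ℝ :=
  ∏ i ∈ S, (1 + τ * spin x i)

theorem spikeProd_eq (τ : ℝ) (S : Finset (Fin n)) (x : Config n) :
    spikeProd τ S x = ∏ i, if i ∈ S then 1 + τ * spin x i else 1 := by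
  rw [spikeProd, Finset.prod_ite_mem, Finset.univ_inter]

theorem spikeProd_nonneg {τ : ℝ} (hτ : |τ| ≤ 1) (S : Finset (Fin n)) (x : Config n) :
    0 ≤ spikeProd τ S x :=
  Finset.prod_nonneg fun i _ => one_add_mul_spin_nonneg hτ x i

theorem prod_ite_mem_const (S : Finset (Fin n)) (w : ℝ) :
    ∏ i, (if i ∈ S then w else 1) = w ^ S.card := by
  rw [Finset.prod_ite_mem, Finset.univ_inter, Finset.prod_const]

theorem iidMean_spikeProd (t τ : ℝ) (S : Finset (Fin n)) :
    iidMean t (spikeProd τ S) = (1 + τ * t) ^ S.card := by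
  have h := iidMean_prod t (fun i y => if i ∈ S then 1 + τ * y else 1)
  simp_rw [← spikeProd_eq τ S] at h
  rw [show spikeProd τ S = fun x => spikeProd τ S x from rfl, h, ← prod_ite_mem_const]
  refine Finset.prod_congr rfl fun i _ => ?_
  split_ifs <;> ring

/-- The mean factorises over sites. On the overlap a site contributes `1 + 2 τ t + τ² ≤ (1 + τ t)²
(1 + τ²)`; all other sites give equality. -/
theorem iidMean_spikeProd_mul_le {t τ : ℝ} (ht : 0 ≤ t) (ht1 : t ≤ 1) (hτ : 0 ≤ τ) (hτ1 : τ ≤ 1)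
    (S U : Finset (Fin n)) :
    iidMean t (fun x => spikeProd τ S x * spikeProd τ U x) ≤
      (1 + τ * t) ^ S.card * (1 + τ * t) ^ U.card * (1 + τ ^ 2) ^ (S ∩ U).card := by
  have h := iidMean_prod t
    (fun i y => (if i ∈ S then 1 + τ * y else 1) * (if i ∈ U then 1 + τ * y else 1))
  simp_rw [Finset.prod_mul_distrib, ← spikeProd_eq τ] at h
  rw [h, ← prod_ite_mem_const, ← prod_ite_mem_const, ← prod_ite_mem_const,
    ← Finset.prod_mul_distrib, ← Finset.prod_mul_distrib]
  have hτt : 0 ≤ τ * t := mul_nonneg hτ ht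
  refine Finset.prod_le_prod (fun i _ => ?_) fun i _ => ?_
  · have h1 : 0 ≤ 1 - t := by linarith
    have h2 : 0 ≤ 1 + τ * -1 := by linarith
    have h3 : 0 ≤ 1 + τ * 1 := by linarith
    split_ifs <;> positivity
  · by_cases hS : i ∈ S <;> by_cases hU : i ∈ U <;> simp only [hS, hU, Finset.mem_inter, and_true,
      and_false, if_true, if_false]
    · nlinarith [mul_nonneg hτt (sq_nonneg τ), mul_nonneg (mul_nonneg hτt hτt) (sq_nonneg τ),
        mul_nonneg hτt hτt]
    all_goals apply le_of_eq; ring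

/-! ### Overlap of two random subsets -/

/-- In probabilistic terms, a uniform `s`-subset contains a given `k`-set with probability at most
`(s / n)^k`, since each factor satisfies `(s - k) / (n - k) ≤ s / n`. -/
theorem choose_sub_mul_pow_le {n s : ℕ} (hsn : s ≤ n) :
    ∀ k, k ≤ s → (n - k).choose (s - k) * n ^ k ≤ n.choose s * s ^ k := by
  intro k
  induction k with
  | zero => simp
  | succ k ih =>
    intro hk
    have ih := ih (by omega)
    have e := Nat.add_one_mul_choose_eq (n - (k + 1)) (s - (k + 1))
    rw [show n - (k + 1) + 1 = n - k by omega, show s - (k + 1) + 1 = s - k by omega] at e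
    have h1 : (s - k) * n ≤ s * (n - k) := by
      rw [Nat.sub_mul, Nat.mul_sub]
      have := Nat.mul_le_mul_left k hsn
      rw [mul_comm k s] at this
      omega
    refine Nat.le_of_mul_le_mul_left ?_ (show 0 < n - k by omega)
    calc (n - k) * ((n - (k + 1)).choose (s - (k + 1)) * n ^ (k + 1))
        = (n - k).choose (s - k) * n ^ k * ((s - k) * n) := by
          rw [← mul_assoc, e, pow_succ]; ring
      _ ≤ n.choose s * s ^ k * (s * (n - k)) := Nat.mul_le_mul ih h1
      _ = (n - k) * (n.choose s * s ^ (k + 1)) := by rw [pow_succ]; ring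

theorem card_filter_superset_le (s : ℕ) (U : Finset (Fin n)) :
    ((Finset.powersetCard s Finset.univ).filter fun S => U ⊆ S).card ≤
      (n - U.card).choose (s - U.card) := by
  have h : (Finset.powersetCard (s - U.card) (Finset.univ \ U)).card =
      (n - U.card).choose (s - U.card) := by
    rw [Finset.card_powersetCard, Finset.card_univ_sdiff, Fintype.card_fin]
  rw [← h]
  refine Finset.card_le_card_of_injOn (fun S => S \ U) (fun S hS => ?_) fun S hS S' hS' hSS => ?_
  · simp only [Finset.coe_filter, Finset.mem_powersetCard] at hS
    simp only [Finset.mem_coe, Finset.mem_powersetCard]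
    exact ⟨Finset.sdiff_subset_sdiff (Finset.subset_univ _) le_rfl,
      by rw [Finset.card_sdiff_of_subset hS.2, hS.1.2]⟩
  · have h1 := (Finset.mem_filter.1 hS).2
    have h2 := (Finset.mem_filter.1 hS').2
    simp only at hSS
    rw [← Finset.sdiff_union_of_subset h1, hSS, Finset.sdiff_union_of_subset h2]

/-- Expanding `(1 + v)^|S ∩ U|` over subsets `W` of `S ∩ U` reduces the average over `U` to the
containment probabilities of the sets `W`. Resummation gives the binomial bound `(1 + v s / n)^s`.
-/
theorem sum_pow_card_inter_le {s : ℕ} (hsn : s ≤ n) (hn : 0 < n) {v : ℝ} (hv : 0 ≤ v)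
    {S : Finset (Fin n)} (hS : S.card = s) :
    ∑ U ∈ Finset.powersetCard s Finset.univ, (1 + v) ^ (S ∩ U).card ≤
      n.choose s * Real.exp (v * s ^ 2 / n) := by
  have hn' : (0 : ℝ) < n := by positivity
  have h1 : ∀ U : Finset (Fin n), (1 + v) ^ (S ∩ U).card =
      ∑ W ∈ S.powerset, if W ⊆ U then v ^ W.card else 0 := by
    intro U
    rw [← Finset.sum_filter, ← Finset.prod_const, Finset.prod_one_add]
    simp_rw [Finset.prod_const]
    refine Finset.sum_congr ?_ fun _ _ => rfl
    ext W
    simp only [Finset.mem_powerset, Finset.mem_filter, Finset.subset_inter_iff]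
  have h2 : ∀ W ∈ S.powerset, ∑ U ∈ Finset.powersetCard s Finset.univ,
      (if W ⊆ U then v ^ W.card else 0) ≤ n.choose s * (v * (s / n)) ^ W.card := by
    intro W hW
    have hk : W.card ≤ s := hS ▸ Finset.card_le_card (Finset.mem_powerset.1 hW)
    have h3 : (((Finset.powersetCard s Finset.univ).filter fun U => W ⊆ U).card : ℝ) *
        n ^ W.card ≤ n.choose s * s ^ W.card := by
      exact_mod_cast (Nat.mul_le_mul_right _ (card_filter_superset_le s W)).trans
        (choose_sub_mul_pow_le hsn _ hk)
    rw [← Finset.sum_filter, Finset.sum_const, nsmul_eq_mul, mul_pow, div_pow]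
    rw [← le_div_iff₀ (by positivity)] at h3
    calc _ ≤ n.choose s * s ^ W.card / (n : ℝ) ^ W.card * v ^ W.card := by gcongr
      _ = _ := by ring
  simp_rw [h1]
  rw [Finset.sum_comm]
  refine (Finset.sum_le_sum h2).trans ?_
  have h4 : ∑ W ∈ S.powerset, (v * (s / n : ℝ)) ^ W.card = (1 + v * (s / n)) ^ s := by
    have := Finset.prod_one_add (f := fun _ : Fin n => v * (s / n : ℝ)) S
    simp_rw [Finset.prod_const] at this
    rw [← this, hS]
  rw [← Finset.mul_sum, h4]
  gcongr
  calc (1 + v * (s / n : ℝ)) ^ s ≤ Real.exp (v * (s / n)) ^ s := by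
        gcongr
        linarith [Real.add_one_le_exp (v * (s / n : ℝ))]
    _ = Real.exp (v * s ^ 2 / n) := by
        rw [← Real.exp_nat_mul]
        congr 1
        ring

/-! ### The averaged likelihood ratio -/

/-- The average of `spikeProd` over all sets of size `s`. -/
noncomputable def avgSpike (τ : ℝ) (s : ℕ) (x : Config n) : ℝ :=
  (n.choose s : ℝ)⁻¹ * ∑ S ∈ Finset.powersetCard s Finset.univ, spikeProd τ S x

theorem avgSpike_nonneg {τ : ℝ} (hτ : |τ| ≤ 1) (s : ℕ) (x : Config n) : 0 ≤ avgSpike τ s x :=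
  mul_nonneg (by positivity) (Finset.sum_nonneg fun S _ => spikeProd_nonneg hτ S x)

theorem choose_cast_pos {s : ℕ} (hsn : s ≤ n) : (0 : ℝ) < n.choose s := by
  exact_mod_cast Nat.choose_pos hsn

theorem card_powersetCard_fin (n s : ℕ) :
    (Finset.powersetCard s (Finset.univ : Finset (Fin n))).card = n.choose s := by
  rw [Finset.card_powersetCard, Finset.card_univ, Fintype.card_fin]

theorem iidMean_avgSpike {s : ℕ} (hsn : s ≤ n) (t τ : ℝ) :
    iidMean (n := n) t (avgSpike τ s) = (1 + τ * t) ^ s := by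
  have hN := choose_cast_pos hsn
  unfold avgSpike
  rw [iidMean_const_mul, iidMean_sum]
  have : ∀ S ∈ Finset.powersetCard s (Finset.univ : Finset (Fin n)),
      iidMean t (fun x => spikeProd τ S x) = (1 + τ * t) ^ s := fun S hS => by
    rw [← (Finset.mem_powersetCard.1 hS).2]
    exact iidMean_spikeProd t τ S
  rw [Finset.sum_congr rfl this, Finset.sum_const, card_powersetCard_fin, nsmul_eq_mul,
    inv_mul_cancel_left₀ hN.ne']

theorem iidMean_avgSpike_sq_le {s : ℕ} (hsn : s ≤ n) (hn : 0 < n) {t τ : ℝ} (ht : 0 ≤ t)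
    (ht1 : t ≤ 1) (hτ : 0 ≤ τ) (hτ1 : τ ≤ 1) :
    iidMean (n := n) t (fun x => avgSpike τ s x ^ 2) ≤
      ((1 + τ * t) ^ s) ^ 2 * Real.exp (τ ^ 2 * s ^ 2 / n) := by
  have hN := choose_cast_pos hsn
  have hb : 0 ≤ 1 + τ * t := by positivity
  have e : ∀ x : Config n, avgSpike τ s x ^ 2 = ((n.choose s : ℝ)⁻¹) ^ 2 *
      ∑ S ∈ Finset.powersetCard s Finset.univ, ∑ U ∈ Finset.powersetCard s Finset.univ,
        spikeProd τ S x * spikeProd τ U x := by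
    intro x
    rw [avgSpike, mul_pow, sq (∑ S ∈ _, spikeProd τ S x), Finset.sum_mul_sum]
  simp_rw [e]
  rw [iidMean_const_mul, iidMean_sum]
  simp_rw [iidMean_sum]
  have h1 : ∀ S ∈ Finset.powersetCard s (Finset.univ : Finset (Fin n)),
      ∑ U ∈ Finset.powersetCard s Finset.univ,
        iidMean t (fun x => spikeProd τ S x * spikeProd τ U x) ≤
      ((1 + τ * t) ^ s) ^ 2 * (n.choose s * Real.exp (τ ^ 2 * s ^ 2 / n)) := by
    intro S hS
    have hSs := (Finset.mem_powersetCard.1 hS).2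
    refine le_trans ?_ (mul_le_mul_of_nonneg_left
      (sum_pow_card_inter_le hsn hn (sq_nonneg τ) hSs) (by positivity))
    rw [Finset.mul_sum]
    refine Finset.sum_le_sum fun U hU => ?_
    have := iidMean_spikeProd_mul_le ht ht1 hτ hτ1 S U
    rwa [hSs, (Finset.mem_powersetCard.1 hU).2, ← sq] at this
  calc _ ≤ ((n.choose s : ℝ)⁻¹) ^ 2 * ∑ S ∈ Finset.powersetCard s (Finset.univ : Finset (Fin n)),
        ((1 + τ * t) ^ s) ^ 2 * (n.choose s * Real.exp (τ ^ 2 * s ^ 2 / n)) := by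
        gcongr with S hS
        exact h1 S hS
    _ = _ := by
        rw [Finset.sum_const, card_powersetCard_fin, nsmul_eq_mul]
        field_simp

/-- Under independent spins, a test with small type I error misses a fixed fraction of the averaged
alternative. -/
theorem le_iidMean_indicator_compl_avgSpike {s : ℕ} (hsn : s ≤ n) (hn : 0 < n) {r t τ K : ℝ}
    (hr : 0 ≤ r) (hrt : r ≤ t) (ht1 : t ≤ 1) (hτ : 0 ≤ τ) (hτ1 : τ ≤ 1) (hK : 0 < K)
    (hKs : Real.exp (τ ^ 2 * s ^ 2 / n) ≤ K) (A : Set (Config n)) :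
    (1 + τ * r) ^ s * (1 / 2 - K / 2 * iidMean t (A.indicator 1)) ≤
      iidMean t (Aᶜ.indicator (avgSpike τ s)) := by
  have ht : 0 ≤ t := hr.trans hrt
  have htabs : |t| ≤ 1 := abs_le.2 ⟨by linarith, ht1⟩
  have hτabs : |τ| ≤ 1 := abs_le.2 ⟨by linarith, hτ1⟩
  set b := (1 + τ * t) ^ s with hb
  have hb0 : 0 < b := by positivity
  have hsplit : iidMean t (Aᶜ.indicator (avgSpike τ s)) =
      b - iidMean t (A.indicator (avgSpike τ s)) := by
    rw [eq_sub_iff_add_eq, ← iidMean_add, hb, ← iidMean_avgSpike hsn]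
    congr 1
    funext x
    exact congrFun (Set.indicator_compl_add_self A (avgSpike τ s)) x
  have hA : iidMean t (A.indicator (avgSpike τ s)) ≤
      b / 2 + b * K / 2 * iidMean t (A.indicator 1) := by
    -- AM-GM balanced at `avgSpike = b K`: since the second moment is at most `b² K`, the quadratic
    -- term contributes at most `b / 2`.
    have h1 : ∀ x, A.indicator (avgSpike τ s) x ≤
        1 / (2 * b * K) * avgSpike τ s x ^ 2 + b * K / 2 * A.indicator 1 x := by
      intro x
      by_cases hx : x ∈ A
      · rw [Set.indicator_of_mem hx, Set.indicator_of_mem hx, Pi.one_apply, mul_one, ← sub_nonneg]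
        have : 1 / (2 * b * K) * avgSpike τ s x ^ 2 + b * K / 2 - avgSpike τ s x =
            1 / (2 * b * K) * (avgSpike τ s x - b * K) ^ 2 := by
          field_simp
          ring
        rw [this]
        positivity
      · rw [Set.indicator_of_notMem hx, Set.indicator_of_notMem hx, mul_zero, add_zero]
        positivity
    refine (iidMean_mono htabs h1).trans ?_
    rw [iidMean_add, iidMean_const_mul, iidMean_const_mul]
    gcongr
    calc 1 / (2 * b * K) * iidMean t (fun x => avgSpike τ s x ^ 2)
        ≤ 1 / (2 * b * K) * (b ^ 2 * K) := by
          gcongr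
          exact (iidMean_avgSpike_sq_le hsn hn ht ht1 hτ hτ1).trans (by gcongr)
      _ = b / 2 := by field_simp
  have hmain : b * (1 / 2 - K / 2 * iidMean t (A.indicator 1)) ≤
      iidMean t (Aᶜ.indicator (avgSpike τ s)) := by
    rw [hsplit]
    linarith
  -- Lowering the base from `t` to `r` is legitimate only when the bracket is nonnegative; otherwise
  -- the claim is trivial.
  rcases le_total 0 (1 / 2 - K / 2 * iidMean t (A.indicator 1)) with h | h
  · refine le_trans (mul_le_mul_of_nonneg_right ?_ h) hmain
    rw [hb]
    gcongr
  · refine (mul_nonpos_of_nonneg_of_nonpos (by positivity) h).trans ?_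
    exact iidMean_nonneg htabs fun x => Set.indicator_nonneg (fun _ _ => avgSpike_nonneg hτabs s _) x

/-! ### The Hubbard-Stratonovich representation -/

/-- The vector with value `B` on `S` and `0` elsewhere. -/
def spike (S : Finset (Fin n)) (B : ℝ) : Fin n → ℝ := fun i => if i ∈ S then B else 0

theorem spike_mem_sparseAlt {S : Finset (Fin n)} {B : ℝ} (hB : 0 < B) :
    spike S B ∈ sparseAlt n S.card B := by
  have h : Function.support (spike S B) = S := by
    ext i
    simp [spike, hB.ne']
  refine ⟨by rw [h, Set.ncard_coe_finset], fun i hi => ?_⟩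
  rw [h] at hi
  simp [spike, Finset.mem_coe.1 hi]

theorem exp_mul_spin (h : ℝ) (x : Config n) (i : Fin n) :
    Real.exp (h * spin x i) = Real.cosh h * (1 + Real.tanh h * spin x i) := by
  rw [Real.tanh_eq_sinh_div_cosh]
  have h1 := (Real.cosh_pos h).ne'
  have h2 : Real.cosh h * (1 + Real.sinh h / Real.cosh h * spin x i) =
      Real.cosh h + Real.sinh h * spin x i := by
    field_simp
  rw [h2]
  rcases spin_eq_or x i with e | e <;> rw [e]
  · rw [mul_one, mul_one, Real.cosh_add_sinh]
  · rw [mul_neg_one, mul_neg_one, ← sub_eq_add_neg, Real.cosh_sub_sinh]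

theorem weight_spike (θ : ℝ) (S : Finset (Fin n)) (B : ℝ) (x : Config n) :
    weight θ (spike S B) x =
      weight θ 0 x * (Real.cosh B ^ S.card * spikeProd (Real.tanh B) S x) := by
  have h : Real.exp (∑ i, spike S B i * spin x i) =
      Real.cosh B ^ S.card * spikeProd (Real.tanh B) S x := by
    simp only [spike, ite_mul, zero_mul]
    rw [Finset.sum_ite_mem, Finset.univ_inter, Real.exp_sum, spikeProd, ← Finset.prod_const,
      ← Finset.prod_mul_distrib]
    exact Finset.prod_congr rfl fun i _ => exp_mul_spin B x i
  rw [weight, weight, Real.exp_add, h]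
  simp

theorem fieldDensity_mul_iidSpin (θ h : ℝ) (x : Config n) :
    fieldDensity θ n h * iidSpin (Real.tanh h) x =
      Real.exp (-(n / (2 * θ)) * h ^ 2 + h * ∑ i, spin x i) := by
  have h1 : (2 * Real.cosh h) ^ n * iidSpin (Real.tanh h) x = Real.exp (h * ∑ i, spin x i) := by
    have e : (2 * Real.cosh h) ^ n = ∏ _i : Fin n, (2 * Real.cosh h) := by simp
    rw [e, iidSpin, ← Finset.prod_mul_distrib, Finset.mul_sum, Real.exp_sum]
    refine Finset.prod_congr rfl fun i _ => ?_
    rw [exp_mul_spin]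
    ring
  rw [fieldDensity, mul_assoc, h1, Real.exp_add]

theorem gaussian_mul_exp {θ : ℝ} (hθ : 0 < θ) (hn : 0 < n) (m h : ℝ) :
    Real.exp (-(n / (2 * θ)) * h ^ 2 + h * m) =
      Real.exp (θ / n * (m ^ 2 / 2)) * Real.exp (-(n / (2 * θ)) * (h - θ / n * m) ^ 2) := by
  have hn' : (n : ℝ) ≠ 0 := by positivity
  rw [← Real.exp_add]
  congr 1
  field_simp
  ring

theorem integrable_fieldDensity_mul_iidSpin {θ : ℝ} (hθ : 0 < θ) (hn : 0 < n) (x : Config n) :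
    MeasureTheory.Integrable fun h => fieldDensity θ n h * iidSpin (Real.tanh h) x := by
  simp_rw [fieldDensity_mul_iidSpin, gaussian_mul_exp hθ hn]
  exact (integrable_gaussian_shift (by positivity) _).const_mul _

/-- The normalisation in the Hubbard-Stratonovich representation. -/
noncomputable def fieldConst (θ : ℝ) (n : ℕ) : ℝ :=
  √(Real.pi / (n / (2 * θ))) * Real.exp (θ / 2)

/-- Completing the square in `h` and integrating the Gaussian leaves `exp (θ m² / (2 n))`, with `m`
the total spin. The factor `exp (θ / 2)` in `fieldConst` accounts for the diagonal terms absent from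
the weight. -/
theorem integral_fieldDensity_mul_iidSpin {θ : ℝ} (hθ : 0 < θ) (hn : 0 < n) (x : Config n) :
    ∫ h, fieldDensity θ n h * iidSpin (Real.tanh h) x = fieldConst θ n * weight θ 0 x := by
  have hn' : (n : ℝ) ≠ 0 := by positivity
  simp_rw [fieldDensity_mul_iidSpin, gaussian_mul_exp hθ hn]
  rw [MeasureTheory.integral_const_mul, integral_gaussian_shift, weight_eq, fieldConst, mul_assoc,
    ← Real.exp_add, mul_comm]
  congr 2
  simp
  field_simp
  ring

theorem integrable_fieldDensity_mul_iidMean {θ : ℝ} (hθ : 0 < θ) (hn : 0 < n)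
    (f : Config n → ℝ) :
    MeasureTheory.Integrable fun h => fieldDensity θ n h * iidMean (Real.tanh h) f := by
  simp_rw [iidMean, Finset.mul_sum, ← mul_assoc]
  exact MeasureTheory.integrable_finsetSum _ fun x _ =>
    (integrable_fieldDensity_mul_iidSpin hθ hn x).mul_const _

theorem integral_fieldDensity_mul_iidMean {θ : ℝ} (hθ : 0 < θ) (hn : 0 < n)
    (f : Config n → ℝ) :
    ∫ h, fieldDensity θ n h * iidMean (Real.tanh h) f =
      fieldConst θ n * ∑ x, weight θ 0 x * f x := by
  simp_rw [iidMean, Finset.mul_sum, ← mul_assoc]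
  rw [MeasureTheory.integral_finsetSum _ fun x _ =>
    (integrable_fieldDensity_mul_iidSpin hθ hn x).mul_const _]
  refine Finset.sum_congr rfl fun x _ => ?_
  rw [MeasureTheory.integral_mul_const, integral_fieldDensity_mul_iidSpin hθ hn]

theorem fieldConst_pos {θ : ℝ} (hθ : 0 < θ) (hn : 0 < n) : 0 < fieldConst θ n := by
  have := Real.pi_pos
  unfold fieldConst
  positivity

/-- The normalising integral depends on `S` only through its cardinality, so all spikes of size `s`
share one denominator and can be averaged. -/
theorem prob_spike_mul {θ : ℝ} (hθ : 0 < θ) (hn : 0 < n) (S : Finset (Fin n)) (B : ℝ)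
    (A : Set (Config n)) :
    prob θ (spike S B) A *
        ∫ h, fieldDensity θ n h * (1 + Real.tanh B * Real.tanh h) ^ S.card =
      ∫ h, fieldDensity θ n h *
        iidMean (Real.tanh h) (A.indicator (spikeProd (Real.tanh B) S)) := by
  have hκ := (fieldConst_pos hθ hn).ne'
  have hc := (pow_pos (Real.cosh_pos B) S.card).ne'
  simp_rw [← iidMean_spikeProd (n := n)]
  rw [integral_fieldDensity_mul_iidMean hθ hn, integral_fieldDensity_mul_iidMean hθ hn]
  have h1 : partitionFn θ (spike S B) = Real.cosh B ^ S.card *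
      ∑ x, weight θ 0 x * spikeProd (Real.tanh B) S x := by
    rw [partitionFn, Finset.mul_sum]
    refine Finset.sum_congr rfl fun x _ => ?_
    rw [weight_spike]
    ring
  have h2 : ∑ x, A.indicator (weight θ (spike S B)) x = Real.cosh B ^ S.card *
      ∑ x, weight θ 0 x * A.indicator (spikeProd (Real.tanh B) S) x := by
    rw [Finset.mul_sum]
    refine Finset.sum_congr rfl fun x _ => ?_
    by_cases hx : x ∈ A
    · rw [Set.indicator_of_mem hx, Set.indicator_of_mem hx, weight_spike]
      ring
    · rw [Set.indicator_of_notMem hx, Set.indicator_of_notMem hx, mul_zero, mul_zero]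
  have hZ := (partitionFn_pos θ (spike S B)).ne'
  rw [prob_eq_div, h2]
  rw [h1] at hZ ⊢
  have := right_ne_zero_of_mul hZ
  field_simp

theorem prob_zero_mul {θ : ℝ} (hθ : 0 < θ) (hn : 0 < n) (A : Set (Config n)) :
    prob θ 0 A * ∫ h, fieldDensity θ n h =
      ∫ h, fieldDensity θ n h * iidMean (Real.tanh h) (A.indicator 1) := by
  have h := prob_spike_mul hθ hn ∅ 0 A
  have e : spike (∅ : Finset (Fin n)) 0 = 0 := by
    funext i
    simp [spike]
  have e2 : spikeProd (Real.tanh 0) (∅ : Finset (Fin n)) = 1 := by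
    funext x
    simp [spikeProd]
  rw [e, e2] at h
  simpa using h

/-! ### The lower bound on the risk -/

/-- The worst-case type II error dominates the average over the uniform prior on `s`-sets. -/
theorem integral_avgSpike_le_risk {θ : ℝ} (hθ : 0 < θ) (hn : 0 < n) {s : ℕ} (hsn : s ≤ n) {B : ℝ}
    (hB : 0 < B) (T : Test n) :
    ∫ h, fieldDensity θ n h *
        iidMean (Real.tanh h) ({x | T x = 0}.indicator (avgSpike (Real.tanh B) s)) ≤
      (⨆ μ : sparseAlt n s B, prob θ (μ : Fin n → ℝ) {x | T x = 0}) *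
        ∫ h, fieldDensity θ n h * (1 + Real.tanh B * Real.tanh h) ^ s := by
  set q := ⨆ μ : sparseAlt n s B, prob θ (μ : Fin n → ℝ) {x | T x = 0} with hq
  set τ := Real.tanh B with hτ
  have hN := choose_cast_pos hsn
  set R := ∫ h, fieldDensity θ n h * (1 + τ * Real.tanh h) ^ s with hR
  have hR0 : 0 ≤ R := MeasureTheory.integral_nonneg fun h => by
    have h1 := Real.abs_tanh_lt_one h
    have h2 := Real.abs_tanh_lt_one B
    have : |τ * Real.tanh h| ≤ 1 := by
      rw [abs_mul]
      exact mul_le_one₀ h2.le (abs_nonneg _) h1.le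
    have : 0 ≤ 1 + τ * Real.tanh h := by linarith [(abs_le.1 this).1]
    have := fieldDensity_pos θ n h
    simp only [Pi.zero_apply]
    positivity
  have e : ∀ x, {x | T x = 0}.indicator (avgSpike τ s) x = (n.choose s : ℝ)⁻¹ *
      ∑ S ∈ Finset.powersetCard s Finset.univ, {x | T x = 0}.indicator (spikeProd τ S) x := by
    intro x
    by_cases hx : x ∈ {x | T x = 0}
    · simp only [Set.indicator_of_mem hx]
      rfl
    · simp only [Set.indicator_of_notMem hx, Finset.sum_const_zero, mul_zero]
  rw [show {x | T x = 0}.indicator (avgSpike τ s) = fun x => _ from funext e]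
  simp_rw [iidMean_const_mul, iidMean_sum, mul_left_comm _ (n.choose s : ℝ)⁻¹, Finset.mul_sum]
  rw [MeasureTheory.integral_finsetSum _ fun S _ =>
    (integrable_fieldDensity_mul_iidMean hθ hn _).const_mul _]
  calc _ ≤ ∑ S ∈ Finset.powersetCard s (Finset.univ : Finset (Fin n)),
        (n.choose s : ℝ)⁻¹ * (q * R) := by
        refine Finset.sum_le_sum fun S hS => ?_
        have hSs := (Finset.mem_powersetCard.1 hS).2
        rw [MeasureTheory.integral_const_mul]
        refine mul_le_mul_of_nonneg_left ?_ (by positivity)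
        have h1 := prob_spike_mul hθ hn S B {x | T x = 0}
        rw [hSs] at h1
        refine h1.symm.le.trans (mul_le_mul_of_nonneg_right ?_ hR0)
        have h2 := spike_mem_sparseAlt (S := S) hB
        rw [hSs] at h2
        exact prob_le_iSup θ T h2
    _ = q * R := by
        rw [Finset.sum_const, card_powersetCard_fin, nsmul_eq_mul, mul_inv_cancel_left₀ hN.ne']

/-- Below the detection threshold the risk of every test is bounded away from zero. -/
theorem exists_le_risk {θ : ℝ} (hθ : 1 < θ) {C : ℝ} (hC : 0 ≤ C) :
    ∃ ε, 0 < ε ∧ ∀ n s : ℕ, 0 < n → s ≤ n → ∀ B : ℝ, 0 < B →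
      s * Real.tanh B ≤ C * √(n : ℝ) → ∀ T : Test n, ε ≤ risk θ s B T := by
  have hθ0 : 0 < θ := by linarith
  obtain ⟨r, hr0, hr⟩ := exists_pos_eq_mul_tanh hθ
  have hrθ : r / θ = Real.tanh r := by
    rw [div_eq_iff hθ0.ne', mul_comm]
    exact hr
  obtain ⟨c, hc0, hrate⟩ := exists_rate_ge_add_sq hr0 hrθ
  set K := Real.exp (C ^ 2) with hK
  have hK1 : 1 ≤ K := Real.one_le_exp (sq_nonneg C)
  set K1 := 2 * √(2 * Real.pi / c) * Real.exp (C ^ 2 / (2 * c)) with hK1def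
  have hK1pos : 0 < K1 := by have := Real.pi_pos; positivity
  set d := Real.exp (-(1 / (2 * θ))) with hd
  have hdpos : 0 < d := Real.exp_pos _
  refine ⟨d / (2 * K1 * K), by positivity, fun n s hn hsn B hB hs T => ?_⟩
  have hn' : (0 : ℝ) < n := by positivity
  set τ := Real.tanh B with hτ
  have hτ0 : 0 < τ := tanh_pos hB
  have hτ1 : τ ≤ 1 := (Real.tanh_lt_one B).le
  set I := Set.Icc r (r + (√(n : ℝ))⁻¹) with hI
  set E := laplaceScale θ r n with hE
  have hEpos : 0 < E := laplaceScale_pos θ r hn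
  set b := (1 + τ * Real.tanh r) ^ s with hb
  have hm : 0 < Real.tanh r := tanh_pos hr0
  have hbpos : 0 < b := by positivity
  set A : Set (Config n) := {x | T x = 1} with hA
  have hAc : {x | T x = 0} = Aᶜ := by
    ext x
    simp only [hA, Set.mem_compl_iff, Set.mem_ofPred_eq]
    omega
  set q := ⨆ μ : sparseAlt n s B, prob θ (μ : Fin n → ℝ) {x | T x = 0} with hq
  have hq0 : 0 ≤ q := Real.iSup_nonneg fun _ => prob_nonneg _ _ _
  have hp0 := prob_nonneg θ 0 A
  have hlow := laplaceScale_le_setIntegral hθ0 hrθ hn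
  have hR1 := integral_fieldDensity_mul_le hr0.le hc0 hrate hn hτ0.le hτ1 hs
  have hR0 : ∫ h, fieldDensity θ n h ≤ K1 * E := by
    have := integral_fieldDensity_mul_le (s := 0) hr0.le hc0 hrate hn le_rfl zero_le_one
      (C := C) (by simp only [mul_zero]; positivity)
    simpa using this
  have hup := integral_avgSpike_le_risk hθ0 hn hsn hB T
  have hnull := prob_zero_mul hθ0 hn A
  have hexp : Real.exp (τ ^ 2 * s ^ 2 / n) ≤ K := by
    rw [hK]
    gcongr
    rw [div_le_iff₀ hn']
    calc τ ^ 2 * s ^ 2 = (s * τ) ^ 2 := by ring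
      _ ≤ (C * √(n : ℝ)) ^ 2 := by gcongr
      _ = C ^ 2 * n := by rw [mul_pow, Real.sq_sqrt hn'.le]
  have i0 := integrable_fieldDensity_mul_iidMean hθ0 hn (A.indicator 1)
  have i1 := integrable_fieldDensity_mul_iidMean hθ0 hn (Aᶜ.indicator (avgSpike τ s))
  have iI : MeasureTheory.IntegrableOn (fieldDensity θ n) I :=
    (continuous_fieldDensity θ n).integrableOn_Icc
  have n0 : ∀ h, 0 ≤ fieldDensity θ n h * iidMean (Real.tanh h) (A.indicator 1) := fun h =>
    mul_nonneg (fieldDensity_pos θ n h).le (iidMean_nonneg (Real.abs_tanh_lt_one h).le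
      fun x => Set.indicator_nonneg (fun _ _ => zero_le_one) x)
  have n1 : ∀ h, 0 ≤ fieldDensity θ n h * iidMean (Real.tanh h) (Aᶜ.indicator (avgSpike τ s)) :=
    fun h => mul_nonneg (fieldDensity_pos θ n h).le (iidMean_nonneg (Real.abs_tanh_lt_one h).le
      fun x => Set.indicator_nonneg
        (fun y _ => avgSpike_nonneg (Real.abs_tanh_lt_one B).le s y) x)
  -- The conditional bound is integrated over the window `I` alone; nonnegativity of the two
  -- integrands allows both test integrals to be extended to the whole line.
  have hmain : b / 2 * (∫ h in I, fieldDensity θ n h) -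
      b * K / 2 * ∫ h, fieldDensity θ n h * iidMean (Real.tanh h) (A.indicator 1) ≤
      ∫ h, fieldDensity θ n h * iidMean (Real.tanh h) (Aᶜ.indicator (avgSpike τ s)) := by
    calc _ ≤ b / 2 * (∫ h in I, fieldDensity θ n h) - b * K / 2 *
          ∫ h in I, fieldDensity θ n h * iidMean (Real.tanh h) (A.indicator 1) := by
          exact sub_le_sub_left (mul_le_mul_of_nonneg_left
            (MeasureTheory.setIntegral_le_integral i0 (Eventually.of_forall n0))
            (by positivity)) _
      _ = ∫ h in I, (b / 2 * fieldDensity θ n h - b * K / 2 *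
          (fieldDensity θ n h * iidMean (Real.tanh h) (A.indicator 1))) := by
          rw [MeasureTheory.integral_sub (iI.const_mul _) (i0.integrableOn.const_mul _),
            MeasureTheory.integral_const_mul, MeasureTheory.integral_const_mul]
      _ ≤ ∫ h in I, fieldDensity θ n h *
          iidMean (Real.tanh h) (Aᶜ.indicator (avgSpike τ s)) := by
          refine MeasureTheory.setIntegral_mono_on
            ((iI.const_mul _).sub (i0.integrableOn.const_mul _)) i1.integrableOn
            measurableSet_Icc fun h hh => ?_
          have := le_iidMean_indicator_compl_avgSpike hsn hn hm.le
            (tanh_strictMono.monotone hh.1) (Real.tanh_lt_one h).le hτ0.le hτ1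
            (by positivity) hexp A
          have := mul_le_mul_of_nonneg_left this (fieldDensity_pos θ n h).le
          linarith
      _ ≤ _ := MeasureTheory.setIntegral_le_integral i1 (Eventually.of_forall n1)
  rw [← hnull] at hmain
  rw [hAc] at hup
  have h1 : b * K / 2 * (prob θ 0 A * ∫ h, fieldDensity θ n h) ≤
      b * K / 2 * (prob θ 0 A * (K1 * E)) := by gcongr
  have h2 : q * ∫ h, fieldDensity θ n h * (1 + τ * Real.tanh h) ^ s ≤ q * (K1 * (E * b)) := by
    gcongr
  have h3 : b / 2 * (d * E) ≤ b / 2 * ∫ h in I, fieldDensity θ n h := by gcongr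
  -- Every term is now of order `b * E`, the common Laplace scale, which cancels and leaves
  -- constants depending on `θ` and `C` only.
  have h4 : (b * E) * (d / 2) ≤ (b * E) * (K1 * K * (prob θ 0 A + q)) := by
    have e1 : b * E * K1 * q ≤ b * E * K1 * q * K := le_mul_of_one_le_right (by positivity) hK1
    have e2 : 0 ≤ b * K * E * K1 * prob θ 0 A := by positivity
    rw [hAc] at hq
    rw [← hq] at hup
    linarith
  have h5 := le_of_mul_le_mul_left h4 (by positivity)
  change _ ≤ prob θ 0 A + q
  rw [div_le_iff₀ (by positivity)]
  linarith

theorem not_asymptoticallyPowerful {θ : ℝ} (hθ : 1 < θ) {s : ℕ → ℕ} (hs : ∀ n, s n ≤ n)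
    {B : ℕ → ℝ} (hB : ∀ n, 0 < B n)
    (h : (fun n => (s n : ℝ) * Real.tanh (B n)) =O[atTop] (fun n : ℕ => √(n : ℝ)))
    (T : ∀ n, Test n) : ¬ AsymptoticallyPowerful θ s B T := by
  rw [asymptoticallyPowerful_iff]
  intro hT
  obtain ⟨C, hC, hb⟩ := h.exists_pos
  obtain ⟨ε, hε, hrisk⟩ := exists_le_risk hθ hC.le
  obtain ⟨n, hn1, hn2, hn3⟩ :=
    ((hT.eventually_lt_const hε).and (hb.bound.and (eventually_gt_atTop 0))).exists
  rw [Real.norm_of_nonneg (mul_nonneg (Nat.cast_nonneg _) (tanh_pos (hB n)).le),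
    Real.norm_of_nonneg (Real.sqrt_nonneg _)] at hn2
  exact (hrisk n (s n) hn3 (hs n) (B n) (hB n) hn2 (T n)).not_gt hn1

end CurieWeiss

theorem theorem2 (θ : ℝ) (hθ : 1 < θ) (s : ℕ → ℕ) (hs : ∀ n, s n ≤ n)
    (B : ℕ → ℝ) (hB : ∀ n, 0 < B n) :
    ((fun n : ℕ => √(n : ℝ)) =o[atTop] (fun n => (s n : ℝ) * Real.tanh (B n)) →
      (∃ L : ℕ → ℝ, Tendsto L atTop atTop ∧
        L =o[atTop] (fun n => (√(n : ℝ))⁻¹ * ((s n : ℝ) * Real.tanh (B n)))) ∧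
      ∀ L : ℕ → ℝ, Tendsto L atTop atTop →
        L =o[atTop] (fun n => (√(n : ℝ))⁻¹ * ((s n : ℝ) * Real.tanh (B n))) →
        CurieWeiss.AsymptoticallyPowerful θ s B (fun n => CurieWeiss.centredTest θ (L n) n)) ∧
    ((fun n => (s n : ℝ) * Real.tanh (B n)) =O[atTop] (fun n : ℕ => √(n : ℝ)) →
      ¬ ∃ T : ∀ n, CurieWeiss.Test n, CurieWeiss.AsymptoticallyPowerful θ s B T) :=
  ⟨fun h => ⟨CurieWeiss.exists_threshold hB h, fun _ hL hLo =>
      CurieWeiss.asymptoticallyPowerful_centredTest (by linarith) hB h hL hLo⟩,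
    fun h ⟨T, hT⟩ => CurieWeiss.not_asymptoticallyPowerful hθ hs hB h T hT⟩
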